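/- Let $p,q\ge 0$, let $A,F$ be constant real $p\times q$ matrices, let $\mathbb K=\mathbb R$ or $\mathbb C$ and $c\in\mathbb K$. On the phase space $T^*SO(p)\times T^*SO(q)$ with variables $k\in SO(p)$, $\ell\in so(p)$, $r\in SO(q)$, $m\in so(q)$ consider the canonical brackets $$\{\ell_{ij},\ell_{mn}\}=\delta_{in}\ell_{jm}+\delta_{jm}\ell_{in}-\delta_{im}\ell_{jn}-\delta_{jn}\ell_{im},\qquad \{\ell_{ij},k_{nm}\}=\delta_{jm}k_{ni}-\delta_{im}k_{nj},$$ the same formulas with $(\ell,k)$ replaced by $(m,r)$, all other brackets of coordinates being zero; they are extended to $\mathbb K$-valued functions by the Leibniz rule and $\mathbb K$-bilinearity. Put $$\mathbf a=\begin{pmatrix}0&kAr^T\\ rA^Tk^T&0\end{pmatrix},\quad \mathbf l=-\begin{pmatrix}k\ell k^T&0\\0&rmr^T\end{pmatrix},\quad \mathbf s=\begin{pmatrix}0&F\\F^T&0\end{pmatrix},\quad y=c\begin{pmatrix}0&F\\-F^T&0\end{pmatrix},$$ $$L=\lambda\mathbf a+\mathbf l+\lambda^{-1}\mathbf s,\qquad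 L_1=L-\tfrac12(y\mathbf a+\mathbf a y),\qquad L_2=1-\lambda^{-1}y,\qquad L_y=L_2^{-1}L_1,$$ where $L_2^{-1}$ is expanded in powers of $\lambda^{-1}$. Let $\mathcal L$ be the algebra of $(p+q)\times(p+q)$ matrix Laurent series in $\lambda^{-1}$ over $\mathbb K$ (finitely many positive powers of $\lambda$), with the pairing $\langle X,Y\rangle=\operatorname{Res}\lambda^{-1}\bigl(-\tfrac12\operatorname{tr}X(\lambda)Y(\lambda)\bigr)d\lambda$, i.e. the coefficient of $\lambda^0$ in $-\frac12\operatorname{tr}XY$. For $d\in\mathbb Z$ let $\pi_d$ be the trace-orthogonal projection of $gl(p+q,\mathbb K)$ onto $\mathfrak f=so(p)\oplus so(q)$ if $d$ is even, and onto $\mathfrak p=\bigl\{\bigl(\begin{smallmatrix}0&S\\S^T&0\end{smallmatrix}\bigr)\bigr\}$ if $d$ is odd (both over $\mathbb K$). Let $P_+$ be the projection $\sum_d x_d\lambda^d\mapsto\sum_{d\ge1}\pi_d(x_d)\lambda^d$ of $\mathcal L$, with image $\mathcal L_+$ and kernel $\mathcal L_-$, and let $P_+^y$ be the projection of $\mathcal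 L=\mathcal L_+(1-\lambda^{-1}y)\dotplus\mathcal L_-(1-\lambda^{-1}y)$ onto the first summand. A spectral invariant is a function $\varphi$ on $\mathcal L$ of the form $\varphi=G(\varphi_1,\dots,\varphi_N)$, where each $\varphi_j$ is a coefficient of some power of $\lambda$ in $\operatorname{tr}L(\lambda)^{k_j}$; it is taken at points where $G:\mathbb K^N\to\mathbb K$ is ($\mathbb K$-)differentiable at the values of the $\varphi_j$. Let $H=\varphi(L_y)$. Then at every such point of the phase space the gradient $dH=d\varphi(L_y)\in\mathcal L$ with respect to $\langle\cdot,\cdot\rangle$ exists and is unique. With $$M=P_+\bigl(dH\,(1-\lambda^{-1}y)^{-1}\bigr),\qquad M_y=P_+^y(dH),$$ one has: 1. $M_y=M(1-\lambda^{-1}y)$. 2. $\{L_y,H\}=[L_y,M_y]$ (entrywise, for every power of $\lambda$). 3. If a curve satisfies Hamilton's equations $\dot u=\{u,H\}$ for all coordinates $u$ at a time $t$ (at which it passes through such a point), then $\frac{d}{dt}L_y=[L_y,M_y]$ at $t$. For an arbitrary curve, the Hamiltonian evolution equations $\frac{d}{dt}L_y=\{L_y,H\}$ of the entries of $L_y$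 at $t$ are equivalent to the Lax equation $\frac{d}{dt}L_y=[L_y,M_y]$ at $t$. 4. For an arbitrary curve, this Lax equation at $t$ is equivalent to the Lax triad $$\frac{d}{dt}L_i=L_i\,M\,L_2-L_2\,M\,L_i,\qquad i=1,2,$$ at $t$. -/

import Mathlib

open scoped Matrix

noncomputable section

namespace SpinTop

/-! ## The phase space and its canonical Poisson bracket -/

/-- Labels of the coordinates `k_{ij}, ℓ_{ij}, r_{ij}, m_{ij}`. -/
inductive Coord (p q : ℕ) : Type
  | k (i j : Fin p) : Coord p q
  | l (i j : Fin p) : Coord p q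
  | r (i j : Fin q) : Coord p q
  | m (i j : Fin q) : Coord p q
  deriving DecidableEq, Fintype

/-- The ambient vector space of quadruples `(k, ℓ, r, m)` of real matrices, in coordinates. -/
abbrev Phase (p q : ℕ) : Type := Coord p q → ℝ

variable {p q : ℕ}

def Phase.k (x : Phase p q) : Matrix (Fin p) (Fin p) ℝ := Matrix.of fun i j => x (Coord.k i j)
def Phase.l (x : Phase p q) : Matrix (Fin p) (Fin p) ℝ := Matrix.of fun i j => x (Coord.l i j)
def Phase.r (x : Phase p q) : Matrix (Fin q) (Fin q) ℝ := Matrix.of fun i j => x (Coord.r i j)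
def Phase.m (x : Phase p q) : Matrix (Fin q) (Fin q) ℝ := Matrix.of fun i j => x (Coord.m i j)

/-- `T^*SO(p) × T^*SO(q)`, trivialised: `k ∈ SO(p)`, `ℓ ∈ so(p)`, `r ∈ SO(q)`, `m ∈ so(q)`. -/
def phaseSpace (p q : ℕ) : Set (Phase p q) :=
  {x | x.kᵀ * x.k = 1 ∧ x.k.det = 1 ∧ x.lᵀ = -x.l ∧
       x.rᵀ * x.r = 1 ∧ x.r.det = 1 ∧ x.mᵀ = -x.m}

/-- Kronecker delta. -/
def δ {n : ℕ} (i j : Fin n) : ℝ := if i = j then 1 else 0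

/-- The brackets `{u, v}` of the coordinate functions, at the point `x`. -/
def poissonTensor (x : Phase p q) : Coord p q → Coord p q → ℝ
  | .l i j, .l m n => δ i n * x.l j m + δ j m * x.l i n - δ i m * x.l j n - δ j n * x.l i m
  | .l i j, .k n m => δ j m * x.k n i - δ i m * x.k n j
  | .k n m, .l i j => -(δ j m * x.k n i - δ i m * x.k n j)
  | .m i j, .m k n => δ i n * x.m j k + δ j k * x.m i n - δ i k * x.m j n - δ j n * x.m i k
  | .m i j, .r n k => δ j k * x.r n i - δ i k * x.r n j
  | .r n k, .m i j => -(δ j k * x.r n i - δ i k * x.r n j)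
  | _, _ => 0

variable {𝕂 : Type*} [RCLike 𝕂]

/-- The partial derivative of a scalar function along the coordinate `u`. -/
def partialDeriv (f : Phase p q → 𝕂) (x : Phase p q) (u : Coord p q) : 𝕂 :=
  deriv (fun ε : ℝ => f (x + ε • Pi.single u 1)) 0

/-- The bracket of two observables (real or complex valued), extended from the coordinates by the
Leibniz rule. On the phase space it depends only on the restrictions of `f` and `g` to it, since
the defining equations of the phase space have zero bracket with every coordinate there. -/
def poissonBracket (f g : Phase p q → 𝕂) (x : Phase p q) : 𝕂 :=
  ∑ u, ∑ v, ((poissonTensor x u v : ℝ) : 𝕂) * partialDeriv f x u * partialDeriv g x v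

/-- At time `t` the curve `γ` satisfies Hamilton's equations `u' = {u, H}`, for all the
coordinates `u`. -/
def IsHamiltonianAt (H : Phase p q → 𝕂) (γ : ℝ → Phase p q) (t : ℝ) : Prop :=
  ∀ u : Coord p q, HasDerivAt (fun s => ((γ s u : ℝ) : 𝕂))
    (poissonBracket (fun x => ((x u : ℝ) : 𝕂)) H (γ t)) t

/-! ## Loops -/

/-- Block matrices of size `p + q`. -/
abbrev Mat (𝕂 : Type*) (p q : ℕ) : Type _ := Matrix (Fin p ⊕ Fin q) (Fin p ⊕ Fin q) 𝕂

/-- Matrix Laurent series in `λ⁻¹` (finitely many positive powers of `λ`). The variable of the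
Laurent series is `λ⁻¹`, so that `λ ^ d` is the monomial of exponent `-d`. -/
abbrev Loop (𝕂 : Type*) [RCLike 𝕂] (p q : ℕ) : Type _ := Mat (LaurentSeries 𝕂) p q

/-- The coefficient of `λ ^ d`. -/
def Loop.coeff (X : Loop 𝕂 p q) (d : ℤ) : Mat 𝕂 p q := Matrix.of fun i j => (X i j).coeff (-d)

/-- The loop `λ ^ d B`. -/
def mono (d : ℤ) (B : Mat 𝕂 p q) : Loop 𝕂 p q :=
  Matrix.of fun i j => HahnSeries.single (-d) (B i j)

/-- The pairing `Res λ⁻¹ (X, Y)` with `(X, Y) = -½ tr X Y`. -/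
def pairing (X Y : Loop 𝕂 p q) : 𝕂 := -(1 / 2) * (X * Y).trace.coeff 0

/-- `X = dφ(L)`: the derivative of `φ` at `L` in each direction `Y` is the pairing of `X`
with `Y`. -/
def IsGradientAt (φ : Loop 𝕂 p q → 𝕂) (L X : Loop 𝕂 p q) : Prop :=
  ∀ Y : Loop 𝕂 p q, HasDerivAt (fun ε : 𝕂 => φ (L + ε • Y)) (pairing X Y) 0

/-- The coefficient of `λ ^ n` in `tr L(λ) ^ k`. -/
def traceCoeff (k : ℕ) (n : ℤ) (L : Loop 𝕂 p q) : 𝕂 := (L ^ k).trace.coeff (-n)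

/-- `φ` is a spectral invariant: a function of finitely many coefficients of the traces
`tr L(λ) ^ k`, differentiable at the values that these coefficients take at `L`. -/
def IsSpectralInvariantAt (φ : Loop 𝕂 p q → 𝕂) (L : Loop 𝕂 p q) : Prop :=
  ∃ (N : ℕ) (k : Fin N → ℕ) (n : Fin N → ℤ) (G : (Fin N → 𝕂) → 𝕂),
    DifferentiableAt 𝕂 G (fun j => traceCoeff (k j) (n j) L) ∧
    φ = fun L' => G (fun j => traceCoeff (k j) (n j) L')

/-- The curve of loops `X` is differentiable at `t` with derivative `X'`, coefficientwise. -/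
def LoopHasDerivAt (X : ℝ → Loop 𝕂 p q) (X' : Loop 𝕂 p q) (t : ℝ) : Prop :=
  ∀ d i j, HasDerivAt (fun s => (X s).coeff d i j) (X'.coeff d i j) t

/-! ## The Lax matrix -/

def aMat (A : Matrix (Fin p) (Fin q) ℝ) (x : Phase p q) : Mat ℝ p q :=
  Matrix.fromBlocks 0 (x.k * A * x.rᵀ) (x.r * Aᵀ * x.kᵀ) 0

def lMat (x : Phase p q) : Mat ℝ p q :=
  -Matrix.fromBlocks (x.k * x.l * x.kᵀ) 0 0 (x.r * x.m * x.rᵀ)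

def sMat (F : Matrix (Fin p) (Fin q) ℝ) : Mat ℝ p q := Matrix.fromBlocks 0 F Fᵀ 0

/-- Real matrices as matrices over `𝕂`. -/
def toK (𝕂 : Type*) [RCLike 𝕂] (B : Mat ℝ p q) : Mat 𝕂 p q := B.map fun b => ((b : ℝ) : 𝕂)

def yMat (F : Matrix (Fin p) (Fin q) ℝ) (c : 𝕂) : Mat 𝕂 p q :=
  c • toK 𝕂 (Matrix.fromBlocks 0 F (-Fᵀ) 0)

/-- The undeformed Lax matrix `L = λ a + l + λ⁻¹ s`. -/
def Lax (𝕂 : Type*) [RCLike 𝕂] (A F : Matrix (Fin p) (Fin q) ℝ) (x : Phase p q) : Loop 𝕂 p q :=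
  mono 1 (toK 𝕂 (aMat A x)) + mono 0 (toK 𝕂 (lMat x)) + mono (-1) (toK 𝕂 (sMat F))

/-- `L₁ = L - ½ (y a + a y)`. -/
def L₁ (A F : Matrix (Fin p) (Fin q) ℝ) (c : 𝕂) (x : Phase p q) : Loop 𝕂 p q :=
  Lax 𝕂 A F x -
    mono 0 ((1 / 2 : 𝕂) • (yMat F c * toK 𝕂 (aMat A x) + toK 𝕂 (aMat A x) * yMat F c))

/-- `1 - λ⁻¹ y`. -/
def oneSub (y : Mat 𝕂 p q) : Loop 𝕂 p q := 1 - mono (-1) y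

/-- `L₂ = 1 - λ⁻¹ y`. -/
def L₂ (F : Matrix (Fin p) (Fin q) ℝ) (c : 𝕂) : Loop 𝕂 p q := oneSub (yMat F c)

/-- The deformed Lax matrix `L_y = (1 - λ⁻¹ y)⁻¹ L₁`. -/
def Ly (A F : Matrix (Fin p) (Fin q) ℝ) (c : 𝕂) (x : Phase p q) : Loop 𝕂 p q :=
  (L₂ F c)⁻¹ * L₁ A F c x

/-! ## The projections `P_+` and `P_+^y` -/

/-- The orthogonal projection (for the trace form) of `gl(p+q)` onto `𝔣 = so(p) ⊕ so(q)` for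
even `d`, and onto the space `𝔭` of symmetric matrices with zero diagonal blocks for odd `d`. -/
def cartanProj (d : ℤ) : Mat 𝕂 p q →ₗ[𝕂] Mat 𝕂 p q where
  toFun X := (1 / 2 : 𝕂) •
    (if Even d then
      Matrix.fromBlocks (X.toBlocks₁₁ - X.toBlocks₁₁ᵀ) 0 0 (X.toBlocks₂₂ - X.toBlocks₂₂ᵀ)
    else
      Matrix.fromBlocks 0 (X.toBlocks₁₂ + X.toBlocks₂₁ᵀ) (X.toBlocks₂₁ + X.toBlocks₁₂ᵀ) 0)
  map_add' X Y := by
    split_ifs <;> ext (i | i) (j | j) <;>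
      simp [Matrix.toBlocks₁₁, Matrix.toBlocks₁₂, Matrix.toBlocks₂₁, Matrix.toBlocks₂₂] <;> ring
  map_smul' c X := by
    split_ifs <;> ext (i | i) (j | j) <;>
      simp [Matrix.toBlocks₁₁, Matrix.toBlocks₁₂, Matrix.toBlocks₂₁, Matrix.toBlocks₂₂] <;> ring

lemma cartanProj_idem (d : ℤ) (X : Mat 𝕂 p q) :
    cartanProj d (cartanProj d X) = cartanProj d X := by
  simp only [cartanProj, LinearMap.coe_mk, AddHom.coe_mk]
  split_ifs <;> ext (i | i) (j | j) <;>
    simp [Matrix.toBlocks₁₁, Matrix.toBlocks₁₂, Matrix.toBlocks₂₁, Matrix.toBlocks₂₂] <;> ring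

@[simp] lemma coeff_add (X Y : Loop 𝕂 p q) (d : ℤ) : (X + Y).coeff d = X.coeff d + Y.coeff d := by
  ext i j; simp [Loop.coeff]

@[simp] lemma coeff_sub (X Y : Loop 𝕂 p q) (d : ℤ) : (X - Y).coeff d = X.coeff d - Y.coeff d := by
  ext i j; simp [Loop.coeff]

@[simp] lemma coeff_smul (c : 𝕂) (X : Loop 𝕂 p q) (d : ℤ) : (c • X).coeff d = c • X.coeff d := by
  ext i j; simp [Loop.coeff]

@[simp] lemma coeff_zero (d : ℤ) : (0 : Loop 𝕂 p q).coeff d = 0 := by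
  ext i j; simp [Loop.coeff]

lemma loop_ext {X Y : Loop 𝕂 p q} (h : ∀ d, X.coeff d = Y.coeff d) : X = Y := by
  ext i j d
  have := congrFun (congrFun (h (-d)) i) j
  simpa [Loop.coeff] using this

/-- The elements `∑_{d ≥ 1} x_d λ ^ d` of the twisted loop algebra: `x_d ∈ 𝔣` for even `d` and
`x_d ∈ 𝔭` for odd `d`. -/
def loopPlus (𝕂 : Type*) [RCLike 𝕂] (p q : ℕ) : Submodule 𝕂 (Loop 𝕂 p q) where
  carrier := {M | ∀ d, if 1 ≤ d then cartanProj d (M.coeff d) = M.coeff d else M.coeff d = 0}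
  add_mem' {a b} ha hb d := by
    have h1 := ha d; have h2 := hb d
    split_ifs at * <;> simp_all
  zero_mem' d := by simp
  smul_mem' c a ha d := by
    have h1 := ha d
    split_ifs at * <;> simp_all

/-- The complement: loops whose positive part has zero component in the twisted loop algebra. -/
def loopMinus (𝕂 : Type*) [RCLike 𝕂] (p q : ℕ) : Submodule 𝕂 (Loop 𝕂 p q) where
  carrier := {N | ∀ d, 1 ≤ d → cartanProj d (N.coeff d) = 0}
  add_mem' {a b} ha hb d hd := by simp [ha d hd, hb d hd]
  zero_mem' d _ := by simp
  smul_mem' c a ha d hd := by simp [ha d hd]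

lemma exists_posPart (X : Loop 𝕂 p q) :
    ∃ M : Loop 𝕂 p q, ∀ d, M.coeff d = if 1 ≤ d then cartanProj d (X.coeff d) else 0 := by
  have hX : ∃ D : ℤ, ∀ d, D < d → X.coeff d = 0 := by
    have h1 : ∀ i j, ∃ D : ℤ, ∀ d, D < d → (X i j).coeff (-d) = 0 := fun i j =>
      ⟨-(X i j).order, fun d hd => HahnSeries.coeff_eq_zero_of_lt_order (by omega)⟩
    choose D hD using h1
    refine ⟨∑ i, ∑ j, |D i j|, fun d hd => ?_⟩
    ext i j
    refine hD i j d (lt_of_le_of_lt ((le_abs_self _).trans ?_) hd)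
    exact (Finset.single_le_sum (f := fun j => |D i j|) (fun _ _ => abs_nonneg _)
      (Finset.mem_univ j)).trans (Finset.single_le_sum (f := fun i => ∑ j, |D i j|)
      (fun _ _ => Finset.sum_nonneg fun _ _ => abs_nonneg _) (Finset.mem_univ i))
  obtain ⟨D, hD⟩ := hX
  refine ⟨∑ e ∈ Finset.Icc 1 D, mono e (cartanProj e (X.coeff e)), fun d => ?_⟩
  ext i j
  have hsum : (∑ e ∈ Finset.Icc 1 D, mono e (cartanProj e (X.coeff e))).coeff d i j =
      ∑ e ∈ Finset.Icc 1 D, if d = e then cartanProj e (X.coeff e) i j else 0 := by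
    simp [Loop.coeff, mono, Matrix.sum_apply, HahnSeries.coeff_sum, HahnSeries.coeff_single]
  rw [hsum, Finset.sum_ite_eq]
  by_cases h1 : 1 ≤ d
  · by_cases h2 : d ≤ D
    · simp [h1, h2]
    · simp [h1, h2, hD d (by omega)]
  · simp [h1]

lemma isCompl_loop : IsCompl (loopPlus 𝕂 p q) (loopMinus 𝕂 p q) := by
  refine IsCompl.of_eq ?_ ?_
  · rw [Submodule.eq_bot_iff]
    rintro M ⟨h1, h2⟩
    refine loop_ext fun d => ?_
    have h3 := h1 d
    by_cases hd : 1 ≤ d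
    · rw [if_pos hd] at h3
      rw [← h3, h2 d hd, coeff_zero]
    · rw [if_neg hd] at h3
      rw [h3, coeff_zero]
  · rw [Submodule.eq_top_iff']
    intro X
    obtain ⟨M, hM⟩ := exists_posPart X
    refine Submodule.mem_sup.2 ⟨M, fun d => ?_, X - M, fun d hd => ?_, by abel⟩
    · by_cases hd : 1 ≤ d
      · simp [hd, hM, cartanProj_idem]
      · simp [hd, hM]
    · simp [hd, hM, cartanProj_idem]

lemma isUnit_oneSub_det (y : Mat 𝕂 p q) : IsUnit (oneSub y).det := by
  classical
  set P : Matrix (Fin p ⊕ Fin q) (Fin p ⊕ Fin q) (PowerSeries 𝕂) :=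
    1 - Matrix.of fun i j => PowerSeries.X * PowerSeries.C (y i j) with hP
  have h1 : oneSub y = (HahnSeries.ofPowerSeries ℤ 𝕂).mapMatrix P := by
    ext1 i j
    simp only [oneSub, mono, hP, map_sub, map_one, Matrix.sub_apply, Matrix.of_apply,
      RingHom.mapMatrix_apply, Matrix.map_apply, map_mul, HahnSeries.ofPowerSeries_X,
      HahnSeries.ofPowerSeries_C, HahnSeries.C_apply, HahnSeries.single_mul_single]
    simp
  have h2 : IsUnit P.det := by
    rw [PowerSeries.isUnit_iff_constantCoeff, RingHom.map_det]
    have h3 : (PowerSeries.constantCoeff (R := 𝕂)).mapMatrix P = 1 := by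
      ext i j
      simp [hP, Matrix.one_apply, apply_ite]
    rw [h3, Matrix.det_one]
    exact isUnit_one
  rw [h1, ← RingHom.map_det]
  exact h2.map _

/-- Right multiplication by `1 - λ⁻¹ y`. -/
def mulOneSub (y : Mat 𝕂 p q) : Loop 𝕂 p q ≃ₗ[𝕂] Loop 𝕂 p q where
  toFun X := X * oneSub y
  invFun X := X * (oneSub y)⁻¹
  map_add' X Y := add_mul X Y _
  map_smul' c X := by
    ext1 i j
    simp only [Matrix.mul_apply, Matrix.smul_apply, RingHom.id_apply, Finset.smul_sum,
      ← HahnSeries.C_mul_eq_smul, mul_assoc]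
  left_inv X := Matrix.mul_nonsing_inv_cancel_right _ _ (isUnit_oneSub_det y)
  right_inv X := Matrix.nonsing_inv_mul_cancel_right _ _ (isUnit_oneSub_det y)

/-- The elements `∑_{d ≥ 1} x_d λ ^ d (1 - λ⁻¹ y)`. -/
def loopPlusY (y : Mat 𝕂 p q) : Submodule 𝕂 (Loop 𝕂 p q) :=
  Submodule.map (mulOneSub y).toLinearMap (loopPlus 𝕂 p q)

def loopMinusY (y : Mat 𝕂 p q) : Submodule 𝕂 (Loop 𝕂 p q) :=
  Submodule.map (mulOneSub y).toLinearMap (loopMinus 𝕂 p q)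

lemma isCompl_loopY (y : Mat 𝕂 p q) : IsCompl (loopPlusY y) (loopMinusY y) :=
  IsCompl.map (Submodule.orderIsoMapComap (mulOneSub y)) isCompl_loop

/-- The projection `P_+` onto `loopPlus` along `loopMinus`. -/
def PPlus (𝕂 : Type*) [RCLike 𝕂] (p q : ℕ) : Loop 𝕂 p q →ₗ[𝕂] Loop 𝕂 p q :=
  Submodule.projection (loopPlus 𝕂 p q) (loopMinus 𝕂 p q) isCompl_loop

/-- The projection `P_+^y` onto `loopPlusY y` along `loopMinusY y`. -/
def PPlusY (y : Mat 𝕂 p q) : Loop 𝕂 p q →ₗ[𝕂] Loop 𝕂 p q :=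
  Submodule.projection (loopPlusY y) (loopMinusY y) (isCompl_loopY y)

/-- The Hamiltonian `H = φ(L_y)` on the phase space. -/
def Ham (A F : Matrix (Fin p) (Fin q) ℝ) (c : 𝕂) (φ : Loop 𝕂 p q → 𝕂) (x : Phase p q) : 𝕂 :=
  φ (Ly A F c x)

/-- `M_y = P_+^y(X)`, to be used with the gradient `X = dφ(L_y)`. -/
def My (F : Matrix (Fin p) (Fin q) ℝ) (c : 𝕂) (X : Loop 𝕂 p q) : Loop 𝕂 p q :=
  PPlusY (yMat F c) X

/-- `M = P_+(X (1 - λ⁻¹ y)⁻¹)`, to be used with the gradient `X = dφ(L_y)`. -/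
def M (F : Matrix (Fin p) (Fin q) ℝ) (c : 𝕂) (X : Loop 𝕂 p q) : Loop 𝕂 p q :=
  PPlus 𝕂 p q (X * (L₂ F c)⁻¹)

/-- Along the curve `γ`, at time `t`, the Lax equation `dL_y/dt = [L_y, M_y]`. -/
def LaxEquationAt (A F : Matrix (Fin p) (Fin q) ℝ) (c : 𝕂) (X : Loop 𝕂 p q)
    (γ : ℝ → Phase p q) (t : ℝ) : Prop :=
  LoopHasDerivAt (fun s => Ly A F c (γ s))
    (Ly A F c (γ t) * My F c X - My F c X * Ly A F c (γ t)) t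

/-- Along the curve `γ`, at time `t`, the Lax triad `dL_i/dt = L_i M L₂ - L₂ M L_i`, `i = 1, 2`. -/
def LaxTriadAt (A F : Matrix (Fin p) (Fin q) ℝ) (c : 𝕂) (X : Loop 𝕂 p q)
    (γ : ℝ → Phase p q) (t : ℝ) : Prop :=
  LoopHasDerivAt (fun s => L₁ A F c (γ s))
    (L₁ A F c (γ t) * M F c X * L₂ F c - L₂ F c * M F c X * L₁ A F c (γ t)) t ∧
  LoopHasDerivAt (fun _ => L₂ F c)
    (L₂ F c * M F c X * L₂ F c - L₂ F c * M F c X * L₂ F c) t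

end SpinTop

end

namespace SpinTop

/-! ### Coefficientwise differentiation of Laurent series. -/

section Series

variable {𝕂 : Type*} [RCLike 𝕂]

/-! The argument is the r-matrix (Adler-Kostant-Symes) mechanism, carried out coefficient by
coefficient. The gradient `X` of a spectral invariant is a combination of powers of `L_y` with
scalar Laurent series as coefficients, so it commutes with `L_y` (`spectralGradient_commute`). For
`Z = X L₂⁻¹` this says `L₁ Z L₂ = L₂ Z L₁`, and, since `L₂` does not depend on the point, `Z` is the
gradient of `H` with respect to `L₁`.

The map `Q ↦ L₁ Q L₂ - L₂ Q L₁` respects the two involutions that define the twisted loop algebra,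
hence commutes with the projections `π_d` (`cartanProj_laxBracketCoeff`). As it kills `Z`, its value
at `M = P_+ Z` is minus its value at the twisted part of `Z` of degree at most `0`. The latter shows
that nothing survives in degrees `≥ 2`, and that degrees `1` and `0` involve only `π_0 Z_0` and
`π_{-1} Z_{-1}`. In negative degrees `P_+ Z` itself leaves a single term, which vanishes because `y`
is a multiple of `J s` (`sMat_mul_yMat`).

The Hamiltonian field moves `a` and `l` by commutators built from the same two matrices
(`var_hamField`), and comparison gives `laxVar_hamField`; the symmetrised correction `-½ (y a + a
y)` makes the degree `0` terms agree. Multiplication by `L₂⁻¹` and `M_y = M L₂` yield the Lax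
equation. Multiplication by `L₂` or its inverse passes between the Lax equation and the triad, whose
second equation reads `0 = 0`. -/

lemma laurentSeries_coeff_mul {f g : LaurentSeries 𝕂} {a b : ℤ}
    (hf : ∀ n < a, f.coeff n = 0) (hg : ∀ n < b, g.coeff n = 0) (n : ℤ) :
    (f * g).coeff n = ∑ i ∈ Finset.Icc a (n - b), f.coeff i * g.coeff (n - i) := by
  rw [HahnSeries.coeff_mul]
  refine Finset.sum_bij_ne_zero (fun ij _ _ => ij.1) ?_ ?_ ?_ ?_
  · rintro ⟨i, j⟩ h h0
    simp only [Finset.mem_antidiagonal, HahnSeries.mem_support] at h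
    rw [Finset.mem_Icc]
    constructor
    · by_contra hi
      exact h.1 (hf i (by omega))
    · by_contra hi
      exact h.2.1 (hg j (by omega))
  · rintro ⟨i, j⟩ h h0 ⟨i', j'⟩ h' h0' hij
    simp only [Finset.mem_antidiagonal] at h h'
    simp only at hij
    ext <;> simp <;> omega
  · intro i hi h0
    refine ⟨(i, n - i), ?_, h0, rfl⟩
    simp only [Finset.mem_antidiagonal, HahnSeries.mem_support]
    exact ⟨left_ne_zero_of_mul h0, right_ne_zero_of_mul h0, by omega⟩
  · rintro ⟨i, j⟩ h h0
    simp only [Finset.mem_antidiagonal] at h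
    rw [← h.2.2, add_sub_cancel_left]

variable {𝔽 : Type*} [NontriviallyNormedField 𝔽] [NormedAlgebra 𝔽 𝕂]

/-- The curve `f` of Laurent series has coefficientwise derivative `f'` at `t`, and the orders of
its values are bounded below. -/
def HasSeriesDerivAt (f : 𝔽 → LaurentSeries 𝕂) (f' : LaurentSeries 𝕂) (t : 𝔽) : Prop :=
  (∃ a : ℤ, ∀ s, ∀ n < a, (f s).coeff n = 0) ∧
    ∀ n, HasDerivAt (fun s => (f s).coeff n) (f'.coeff n) t

lemma laurentSeries_exists_bound (f : LaurentSeries 𝕂) : ∃ a : ℤ, ∀ n < a, f.coeff n = 0 :=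
  ⟨f.order, fun _ hn => HahnSeries.coeff_eq_zero_of_lt_order hn⟩

lemma HasSeriesDerivAt.const (f : LaurentSeries 𝕂) (t : 𝔽) :
    HasSeriesDerivAt (fun _ => f) 0 t := by
  obtain ⟨a, ha⟩ := laurentSeries_exists_bound f
  exact ⟨⟨a, fun _ => ha⟩, fun n => hasDerivAt_const t _⟩

lemma HasSeriesDerivAt.add {f g : 𝔽 → LaurentSeries 𝕂} {f' g' : LaurentSeries 𝕂} {t : 𝔽}
    (hf : HasSeriesDerivAt f f' t) (hg : HasSeriesDerivAt g g' t) :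
    HasSeriesDerivAt (fun s => f s + g s) (f' + g') t := by
  obtain ⟨⟨a, ha⟩, hf⟩ := hf
  obtain ⟨⟨b, hb⟩, hg⟩ := hg
  refine ⟨⟨min a b, fun s n hn => ?_⟩, fun n => (hf n).add (hg n)⟩
  rw [HahnSeries.coeff_add, ha s n (by omega), hb s n (by omega), add_zero]

lemma HasSeriesDerivAt.sum {ι : Type*} (S : Finset ι) {f : ι → 𝔽 → LaurentSeries 𝕂}
    {f' : ι → LaurentSeries 𝕂} {t : 𝔽} (hf : ∀ i ∈ S, HasSeriesDerivAt (f i) (f' i) t) :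
    HasSeriesDerivAt (fun s => ∑ i ∈ S, f i s) (∑ i ∈ S, f' i) t := by
  classical
  induction S using Finset.induction_on with
  | empty => simpa using HasSeriesDerivAt.const (𝔽 := 𝔽) (0 : LaurentSeries 𝕂) t
  | insert i S hi ih =>
    simp only [Finset.sum_insert hi]
    exact (hf i (Finset.mem_insert_self _ _)).add
      (ih fun j hj => hf j (Finset.mem_insert_of_mem hj))

/-- The bound on orders, uniform along the curve, makes each coefficient of the product a finite sum
over a range independent of the parameter; the ordinary product rule then applies termwise. -/
lemma HasSeriesDerivAt.mul {f g : 𝔽 → LaurentSeries 𝕂} {f' g' : LaurentSeries 𝕂} {t : 𝔽}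
    (hf : HasSeriesDerivAt f f' t) (hg : HasSeriesDerivAt g g' t) :
    HasSeriesDerivAt (fun s => f s * g s) (f' * g t + f t * g') t := by
  obtain ⟨⟨a, ha⟩, hf⟩ := hf
  obtain ⟨⟨b, hb⟩, hg⟩ := hg
  -- The derivative inherits the lower bound on exponents, so every product below is a sum over the
  -- same finite range.
  have ha' : ∀ n < a, f'.coeff n = 0 := fun n hn => by
    have h := hf n
    simp only [fun s => ha s n hn] at h
    exact h.unique (hasDerivAt_const t 0)
  have hb' : ∀ n < b, g'.coeff n = 0 := fun n hn => by
    have h := hg n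
    simp only [fun s => hb s n hn] at h
    exact h.unique (hasDerivAt_const t 0)
  refine ⟨⟨a + b, fun s n hn => ?_⟩, fun n => ?_⟩
  · rw [laurentSeries_coeff_mul (ha s) (hb s), Finset.Icc_eq_empty (by omega), Finset.sum_empty]
  · simp only [fun s => laurentSeries_coeff_mul (ha s) (hb s) n]
    rw [HahnSeries.coeff_add, laurentSeries_coeff_mul ha' (hb t),
      laurentSeries_coeff_mul (ha t) hb', ← Finset.sum_add_distrib]
    exact HasDerivAt.fun_sum fun i _ => (hf i).mul (hg (n - i))

lemma HasSeriesDerivAt.single {f : 𝔽 → 𝕂} {f' : 𝕂} {t : 𝔽} (hf : HasDerivAt f f' t) (d : ℤ) :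
    HasSeriesDerivAt (fun s => HahnSeries.single d (f s)) (HahnSeries.single d f') t := by
  refine ⟨⟨d, fun s n hn => HahnSeries.coeff_single_of_ne (by omega)⟩, fun n => ?_⟩
  by_cases h : n = d
  · subst h
    simpa using hf
  · simpa [HahnSeries.coeff_single_of_ne h] using hasDerivAt_const t (0 : 𝕂)

end Series

/-! ### Differentiation of loops and gradients of spectral invariants. -/

section Loops

variable {p q : ℕ} {𝕂 : Type*} [RCLike 𝕂]
variable {𝔽 : Type*} [NontriviallyNormedField 𝔽] [NormedAlgebra 𝔽 𝕂]

/-- Entrywise `HasSeriesDerivAt`. -/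
def HasLoopDerivAt (X : 𝔽 → Loop 𝕂 p q) (X' : Loop 𝕂 p q) (t : 𝔽) : Prop :=
  ∀ i j, HasSeriesDerivAt (fun s => X s i j) (X' i j) t

lemma HasLoopDerivAt.const (X : Loop 𝕂 p q) (t : 𝔽) : HasLoopDerivAt (fun _ => X) 0 t :=
  fun _ _ => HasSeriesDerivAt.const _ t

lemma HasLoopDerivAt.add {X Y : 𝔽 → Loop 𝕂 p q} {X' Y' : Loop 𝕂 p q} {t : 𝔽}
    (hX : HasLoopDerivAt X X' t) (hY : HasLoopDerivAt Y Y' t) :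
    HasLoopDerivAt (fun s => X s + Y s) (X' + Y') t :=
  fun i j => (hX i j).add (hY i j)

lemma HasLoopDerivAt.mul {X Y : 𝔽 → Loop 𝕂 p q} {X' Y' : Loop 𝕂 p q} {t : 𝔽}
    (hX : HasLoopDerivAt X X' t) (hY : HasLoopDerivAt Y Y' t) :
    HasLoopDerivAt (fun s => X s * Y s) (X' * Y t + X t * Y') t := by
  intro i j
  simp only [Matrix.mul_apply, Matrix.add_apply, ← Finset.sum_add_distrib]
  exact HasSeriesDerivAt.sum _ fun k _ => (hX i k).mul (hY k j)

lemma HasLoopDerivAt.const_mul (Y : Loop 𝕂 p q) {X : 𝔽 → Loop 𝕂 p q} {X' : Loop 𝕂 p q} {t : 𝔽}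
    (hX : HasLoopDerivAt X X' t) : HasLoopDerivAt (fun s => Y * X s) (Y * X') t := by
  simpa using (HasLoopDerivAt.const Y t).mul hX

lemma HasLoopDerivAt.mono {B : 𝔽 → Mat 𝕂 p q} {B' : Mat 𝕂 p q} {t : 𝔽}
    (hB : ∀ i j, HasDerivAt (fun s => B s i j) (B' i j) t) (d : ℤ) :
    HasLoopDerivAt (fun s => mono d (B s)) (mono d B') t :=
  fun i j => HasSeriesDerivAt.single (hB i j) (-d)

lemma HasLoopDerivAt.trace {X : 𝔽 → Loop 𝕂 p q} {X' : Loop 𝕂 p q} {t : 𝔽}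
    (hX : HasLoopDerivAt X X' t) : HasSeriesDerivAt (fun s => (X s).trace) X'.trace t :=
  HasSeriesDerivAt.sum _ fun i _ => hX i i

lemma HasLoopDerivAt.coeff {X : 𝔽 → Loop 𝕂 p q} {X' : Loop 𝕂 p q} {t : 𝔽}
    (hX : HasLoopDerivAt X X' t) (d : ℤ) (i j : Fin p ⊕ Fin q) :
    HasDerivAt (fun s => (X s).coeff d i j) (X'.coeff d i j) t :=
  (hX i j).2 (-d)

lemma HasLoopDerivAt.line (L Y : Loop 𝕂 p q) :
    HasLoopDerivAt (fun ε : 𝕂 => L + ε • Y) Y 0 := by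
  intro i j
  obtain ⟨a, ha⟩ := laurentSeries_exists_bound (L i j)
  obtain ⟨b, hb⟩ := laurentSeries_exists_bound (Y i j)
  refine ⟨⟨min a b, fun s n hn => ?_⟩, fun n => ?_⟩
  · simp [ha n (by omega), hb n (by omega)]
  · simpa using ((hasDerivAt_id (0 : 𝕂)).mul_const ((Y i j).coeff n)).const_add ((L i j).coeff n)

/-- The derivative of a power has no closed commutative form, but only its trace matters, and there
cyclicity gathers the factors. A general `Z` commuting with `X t` is carried along because the
induction replaces `Z` by `Z * X t`. -/
lemma HasLoopDerivAt.exists_pow {X : 𝔽 → Loop 𝕂 p q} {X' : Loop 𝕂 p q} {t : 𝔽}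
    (hX : HasLoopDerivAt X X' t) (k : ℕ) :
    ∃ D, HasLoopDerivAt (fun s => X s ^ k) D t ∧
      ∀ Z, Commute Z (X t) → (Z * D).trace = k * (Z * X t ^ (k - 1) * X').trace := by
  induction k with
  | zero => exact ⟨0, by simpa using HasLoopDerivAt.const 1 t, by simp⟩
  | succ k ih =>
    obtain ⟨D, hD, h⟩ := ih
    refine ⟨D * X t + X t ^ k * X', by simpa only [pow_succ] using hD.mul hX, fun Z hZ => ?_⟩
    have h1 : (Z * (D * X t)).trace = (Z * X t * D).trace := by
      rw [← mul_assoc, Matrix.trace_mul_comm, ← mul_assoc, hZ.eq]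
    have h2 := h (Z * X t) (hZ.mul_left (Commute.refl _))
    rw [mul_add, Matrix.trace_add, h1, h2]
    -- The exponent `k - 1` is truncated at `k = 0`, where the factor `k` removes the term.
    rcases k with _ | k
    · simp
    · rw [mul_assoc Z, Nat.add_sub_cancel, Nat.add_sub_cancel, ← pow_succ', ← mul_assoc]
      push_cast
      ring

lemma HasLoopDerivAt.traceCoeff {X : 𝔽 → Loop 𝕂 p q} {X' : Loop 𝕂 p q} {t : 𝔽}
    (hX : HasLoopDerivAt X X' t) (k : ℕ) (n : ℤ) :
    HasDerivAt (fun s => traceCoeff k n (X s))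
      (k * (X t ^ (k - 1) * X').trace.coeff (-n)) t := by
  obtain ⟨D, hD, h⟩ := hX.exists_pow k
  have h1 := hD.trace.2 (-n)
  have h2 := h 1 (Commute.one_left _)
  rw [one_mul, one_mul] at h2
  rw [h2, ← nsmul_eq_mul, HahnSeries.coeff_nsmul, Pi.smul_apply, nsmul_eq_mul] at h1
  exact h1

/-- The gradient `-2 ∑ⱼ gⱼ kⱼ λ ^ (-nⱼ) L ^ (kⱼ - 1)` of `∑ⱼ gⱼ traceCoeff kⱼ nⱼ`. -/
noncomputable def spectralGradient {N : ℕ} (k : Fin N → ℕ) (n : Fin N → ℤ) (g : Fin N → 𝕂)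
    (L : Loop 𝕂 p q) : Loop 𝕂 p q :=
  ∑ j, (HahnSeries.single (n j) (-2 * g j * k j) : LaurentSeries 𝕂) • L ^ (k j - 1)

lemma spectralGradient_commute {N : ℕ} (k : Fin N → ℕ) (n : Fin N → ℤ) (g : Fin N → 𝕂)
    (L : Loop 𝕂 p q) : Commute (spectralGradient k n g L) L :=
  Commute.sum_left _ _ _ fun _ _ => ((Commute.refl L).pow_left _).smul_left _

lemma pairing_spectralGradient {N : ℕ} (k : Fin N → ℕ) (n : Fin N → ℤ) (g : Fin N → 𝕂)
    (L Y : Loop 𝕂 p q) : pairing (spectralGradient k n g L) Y =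
      ∑ j, g j * (k j * (L ^ (k j - 1) * Y).trace.coeff (-n j)) := by
  rw [pairing, spectralGradient, Finset.sum_mul, Matrix.trace_sum, HahnSeries.coeff_sum,
    Finset.mul_sum]
  refine Finset.sum_congr rfl fun j _ => ?_
  rw [Matrix.smul_mul, Matrix.trace_smul, smul_eq_mul,
    show (0 : ℤ) = -n j + n j by ring, HahnSeries.coeff_single_mul_add]
  ring

/-- The parameter field stays general since two cases are needed: `𝕂` for the lines that define the
gradient, and `ℝ` for curves coming from the phase space. -/
lemma HasLoopDerivAt.comp_spectral {X : 𝔽 → Loop 𝕂 p q} {X' : Loop 𝕂 p q} {t : 𝔽}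
    (hX : HasLoopDerivAt X X' t) {N : ℕ} (k : Fin N → ℕ) (n : Fin N → ℤ) {G : (Fin N → 𝕂) → 𝕂}
    {G' : (Fin N → 𝕂) →L[𝕂] 𝕂}
    (hG : HasFDerivAt G G' (fun j => SpinTop.traceCoeff (k j) (n j) (X t))) :
    HasDerivAt (fun s => G (fun j => SpinTop.traceCoeff (k j) (n j) (X s)))
      (pairing (spectralGradient k n (fun j => G' (Pi.single j 1)) (X t)) X') t := by
  have h1 : HasDerivAt (fun s j => SpinTop.traceCoeff (k j) (n j) (X s))
      (fun j => (k j : 𝕂) * (X t ^ (k j - 1) * X').trace.coeff (-n j)) t :=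
    hasDerivAt_pi.2 fun j => hX.traceCoeff (k j) (n j)
  have h2 := (hG.restrictScalars 𝔽).comp_hasDerivAt t h1
  have h3 : ∀ (j : Fin N) (b : 𝕂), (Pi.single j b : Fin N → 𝕂) = b • Pi.single j 1 := fun j b => by
    rw [← Pi.single_smul, smul_eq_mul, mul_one]
  have h4 : pairing (spectralGradient k n (fun j => G' (Pi.single j 1)) (X t)) X' =
      G' (fun j => (k j : 𝕂) * (X t ^ (k j - 1) * X').trace.coeff (-n j)) := by
    rw [pairing_spectralGradient,
      ← Finset.univ_sum_single (fun j => (k j : 𝕂) * (X t ^ (k j - 1) * X').trace.coeff (-n j)),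
      map_sum]
    refine Finset.sum_congr rfl fun j _ => ?_
    rw [h3 j (_ * _), map_smul, smul_eq_mul, mul_comm]
  rw [h4]
  exact h2

end Loops

/-! ### Variations of the Lax matrix and the Hamiltonian vector field in matrix form. -/

section PhaseDerivative

variable {p q : ℕ} {𝕂 : Type*} [RCLike 𝕂]

lemma mono_add (d : ℤ) (B C : Mat 𝕂 p q) : mono d (B + C) = mono d B + mono d C := by
  ext1 i j; simp [mono]

lemma mono_neg (d : ℤ) (B : Mat 𝕂 p q) : mono d (-B) = -mono d B := by
  ext1 i j; simp [mono]

lemma mono_sub (d : ℤ) (B C : Mat 𝕂 p q) : mono d (B - C) = mono d B - mono d C := by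
  ext1 i j; simp [mono]

lemma mono_smul (d : ℤ) (b : 𝕂) (B : Mat 𝕂 p q) : mono d (b • B) = b • mono d B := by
  ext i j n
  by_cases h : n = -d <;> simp [mono, h]

lemma loop_mul_smul (Y : Loop 𝕂 p q) (b : 𝕂) (Z : Loop 𝕂 p q) : Y * (b • Z) = b • (Y * Z) := by
  ext1 i j
  simp only [Matrix.mul_apply, Matrix.smul_apply, Finset.smul_sum, ← HahnSeries.C_mul_eq_smul]
  exact Finset.sum_congr rfl fun _ _ => by ring

lemma toK_mul (B C : Mat ℝ p q) : toK 𝕂 (B * C) = toK 𝕂 B * toK 𝕂 C :=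
  Matrix.map_mul (f := algebraMap ℝ 𝕂)

/-- The block diagonal matrix `diag(k, r)` of a vector with coordinates `k, ℓ, r, m`. -/
noncomputable def baseMat : (Coord p q → 𝕂) →ₗ[𝕂] Mat 𝕂 p q where
  toFun v := Matrix.fromBlocks (Matrix.of fun i j => v (.k i j)) 0 0
    (Matrix.of fun i j => v (.r i j))
  map_add' v w := by ext (i | i) (j | j) <;> simp
  map_smul' b v := by ext (i | i) (j | j) <;> simp

/-- The block diagonal matrix `diag(ℓ, m)` of a vector with coordinates `k, ℓ, r, m`. -/
noncomputable def momMat : (Coord p q → 𝕂) →ₗ[𝕂] Mat 𝕂 p q where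
  toFun v := Matrix.fromBlocks (Matrix.of fun i j => v (.l i j)) 0 0
    (Matrix.of fun i j => v (.m i j))
  map_add' v w := by ext (i | i) (j | j) <;> simp
  map_smul' b v := by ext (i | i) (j | j) <;> simp

/-- The coordinates of a point of the phase space as elements of `𝕂`. -/
def castPhase (𝕂 : Type*) [RCLike 𝕂] (x : Phase p q) : Coord p q → 𝕂 := fun u => ((x u : ℝ) : 𝕂)

lemma baseMat_castPhase (x : Phase p q) :
    baseMat (castPhase 𝕂 x) = toK 𝕂 (Matrix.fromBlocks x.k 0 0 x.r) := by
  ext (i | i) (j | j) <;> simp [baseMat, castPhase, toK, Phase.k, Phase.r]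

lemma momMat_castPhase (x : Phase p q) :
    momMat (castPhase 𝕂 x) = toK 𝕂 (Matrix.fromBlocks x.l 0 0 x.m) := by
  ext (i | i) (j | j) <;> simp [momMat, castPhase, toK, Phase.l, Phase.m]

lemma toK_transpose (B : Mat ℝ p q) : (toK 𝕂 B)ᵀ = toK 𝕂 Bᵀ := rfl

lemma toK_neg (B : Mat ℝ p q) : toK 𝕂 (-B) = -toK 𝕂 B := by
  ext i j; simp [toK]

lemma toK_one : toK 𝕂 (1 : Mat ℝ p q) = 1 := by
  ext i j; simp [toK, Matrix.one_apply, apply_ite]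

/-- With `K = diag(k, r)` both factors of the phase space are treated at once. -/
lemma toK_aMat (A : Matrix (Fin p) (Fin q) ℝ) (x : Phase p q) :
    toK 𝕂 (aMat A x) =
      baseMat (castPhase 𝕂 x) * toK 𝕂 (sMat A) * (baseMat (castPhase 𝕂 x))ᵀ := by
  rw [baseMat_castPhase, toK_transpose, ← toK_mul, ← toK_mul, Matrix.fromBlocks_transpose, sMat,
    Matrix.fromBlocks_multiply, Matrix.fromBlocks_multiply]
  simp [aMat]

lemma toK_lMat (x : Phase p q) :
    toK 𝕂 (lMat x) =
      -(baseMat (castPhase 𝕂 x) * momMat (castPhase 𝕂 x) * (baseMat (castPhase 𝕂 x))ᵀ) := by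
  rw [baseMat_castPhase, momMat_castPhase, toK_transpose, ← toK_mul, ← toK_mul, ← toK_neg,
    Matrix.fromBlocks_transpose, Matrix.fromBlocks_multiply, Matrix.fromBlocks_multiply]
  simp [lMat]

/-- The derivative of `a` at `x` in the direction `v`. -/
noncomputable def aVar (A : Matrix (Fin p) (Fin q) ℝ) (x : Phase p q) (v : Coord p q → 𝕂) :
    Mat 𝕂 p q :=
  baseMat v * toK 𝕂 (sMat A) * (baseMat (castPhase 𝕂 x))ᵀ +
    baseMat (castPhase 𝕂 x) * toK 𝕂 (sMat A) * (baseMat v)ᵀ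

/-- The derivative of `l` at `x` in the direction `v`. -/
noncomputable def lVar (x : Phase p q) (v : Coord p q → 𝕂) : Mat 𝕂 p q :=
  -((baseMat v * momMat (castPhase 𝕂 x) + baseMat (castPhase 𝕂 x) * momMat v) *
      (baseMat (castPhase 𝕂 x))ᵀ +
    baseMat (castPhase 𝕂 x) * momMat (castPhase 𝕂 x) * (baseMat v)ᵀ)

/-- The derivative of `l - ½ (y a + a y)` at `x` in the direction `v`. -/
noncomputable def lyVar (A F : Matrix (Fin p) (Fin q) ℝ) (c : 𝕂) (x : Phase p q)
    (v : Coord p q → 𝕂) : Mat 𝕂 p q :=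
  lVar x v - (1 / 2 : 𝕂) • (yMat F c * aVar A x v + aVar A x v * yMat F c)

/-- The derivative of `L₁` at `x` in the direction `v`. -/
noncomputable def laxVar (A F : Matrix (Fin p) (Fin q) ℝ) (c : 𝕂) (x : Phase p q) :
    (Coord p q → 𝕂) →ₗ[𝕂] Loop 𝕂 p q where
  toFun v := mono 1 (aVar A x v) + mono 0 (lyVar A F c x v)
  map_add' v w := by
    simp only [lyVar, aVar, lVar, map_add, Matrix.transpose_add, mul_add, add_mul, mono_add,
      mono_sub, mono_neg, smul_add]
    abel
  map_smul' b v := by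
    simp only [lyVar, aVar, lVar, map_smul, Matrix.transpose_smul, Matrix.mul_smul,
      Matrix.smul_mul, mul_add, add_mul, mono_add, mono_sub, mono_neg, mono_smul, smul_add,
      smul_sub, smul_neg, RingHom.id_apply, smul_comm (1 / 2 : 𝕂) b]

/-- Entrywise differentiability of a curve of matrices. -/
def HasMatDerivAt (B : ℝ → Mat 𝕂 p q) (B' : Mat 𝕂 p q) (t : ℝ) : Prop :=
  ∀ i j, HasDerivAt (fun s => B s i j) (B' i j) t

lemma HasMatDerivAt.const (B : Mat 𝕂 p q) (t : ℝ) : HasMatDerivAt (fun _ => B) 0 t :=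
  fun _ _ => hasDerivAt_const t _

lemma HasMatDerivAt.mul {B C : ℝ → Mat 𝕂 p q} {B' C' : Mat 𝕂 p q} {t : ℝ}
    (hB : HasMatDerivAt B B' t) (hC : HasMatDerivAt C C' t) :
    HasMatDerivAt (fun s => B s * C s) (B' * C t + B t * C') t := by
  intro i j
  simp only [Matrix.mul_apply, Matrix.add_apply, ← Finset.sum_add_distrib]
  exact HasDerivAt.fun_sum fun k _ => (hB i k).mul (hC k j)

lemma HasMatDerivAt.transpose {B : ℝ → Mat 𝕂 p q} {B' : Mat 𝕂 p q} {t : ℝ}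
    (hB : HasMatDerivAt B B' t) : HasMatDerivAt (fun s => (B s)ᵀ) B'ᵀ t :=
  fun i j => hB j i

variable {γ : ℝ → Phase p q} {v : Coord p q → 𝕂} {t : ℝ}

lemma hasMatDerivAt_baseMat (hγ : ∀ u, HasDerivAt (fun s => ((γ s u : ℝ) : 𝕂)) (v u) t) :
    HasMatDerivAt (fun s => baseMat (castPhase 𝕂 (γ s))) (baseMat v) t := by
  rintro (i | i) (j | j)
  · exact hγ (.k i j)
  · exact hasDerivAt_const t 0
  · exact hasDerivAt_const t 0
  · exact hγ (.r i j)

lemma hasMatDerivAt_momMat (hγ : ∀ u, HasDerivAt (fun s => ((γ s u : ℝ) : 𝕂)) (v u) t) :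
    HasMatDerivAt (fun s => momMat (castPhase 𝕂 (γ s))) (momMat v) t := by
  rintro (i | i) (j | j)
  · exact hγ (.l i j)
  · exact hasDerivAt_const t 0
  · exact hasDerivAt_const t 0
  · exact hγ (.m i j)

lemma hasMatDerivAt_aMat (A : Matrix (Fin p) (Fin q) ℝ)
    (hγ : ∀ u, HasDerivAt (fun s => ((γ s u : ℝ) : 𝕂)) (v u) t) :
    HasMatDerivAt (fun s => toK 𝕂 (aMat A (γ s))) (aVar A (γ t) v) t := by
  simp only [toK_aMat]
  have hB := hasMatDerivAt_baseMat hγ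
  simpa [aVar] using (hB.mul (HasMatDerivAt.const (toK 𝕂 (sMat A)) t)).mul hB.transpose

lemma hasMatDerivAt_lMat (hγ : ∀ u, HasDerivAt (fun s => ((γ s u : ℝ) : 𝕂)) (v u) t) :
    HasMatDerivAt (fun s => toK 𝕂 (lMat (γ s))) (lVar (γ t) v) t := by
  simp only [toK_lMat]
  have hB := hasMatDerivAt_baseMat hγ
  have h := (hB.mul (hasMatDerivAt_momMat hγ)).mul hB.transpose
  exact fun i j => (h i j).neg

/-- The coefficient `l - ½ (y a + a y)` of `λ ^ 0` in `L₁`. -/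
noncomputable def lyMat (A F : Matrix (Fin p) (Fin q) ℝ) (c : 𝕂) (x : Phase p q) : Mat 𝕂 p q :=
  toK 𝕂 (lMat x) -
    (1 / 2 : 𝕂) • (yMat F c * toK 𝕂 (aMat A x) + toK 𝕂 (aMat A x) * yMat F c)

lemma L₁_eq (A F : Matrix (Fin p) (Fin q) ℝ) (c : 𝕂) (x : Phase p q) :
    L₁ A F c x =
      mono 1 (toK 𝕂 (aMat A x)) + mono 0 (lyMat A F c x) + mono (-1) (toK 𝕂 (sMat F)) := by
  rw [L₁, Lax, lyMat, mono_sub]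
  abel

lemma hasLoopDerivAt_L₁ (A F : Matrix (Fin p) (Fin q) ℝ) (c : 𝕂)
    (hγ : ∀ u, HasDerivAt (fun s => ((γ s u : ℝ) : 𝕂)) (v u) t) :
    HasLoopDerivAt (fun s => L₁ A F c (γ s)) (laxVar A F c (γ t) v) t := by
  simp only [L₁_eq]
  have ha := hasMatDerivAt_aMat A hγ
  have hl := hasMatDerivAt_lMat hγ
  have hy := HasMatDerivAt.const (yMat F c) t
  have hly : HasMatDerivAt (fun s => lyMat A F c (γ s)) (lyVar A F c (γ t) v) t := by
    intro i j
    have h := (hl i j).sub ((((hy.mul ha) i j).add ((ha.mul hy) i j)).const_mul (1 / 2 : 𝕂))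
    simp only [Matrix.zero_mul, Matrix.mul_zero, zero_add, add_zero] at h
    exact h
  simpa [laxVar] using ((HasLoopDerivAt.mono ha 1).add (HasLoopDerivAt.mono hly 0)).add
    (HasLoopDerivAt.const (mono (-1) (toK 𝕂 (sMat F))) t)

lemma hasLoopDerivAt_Ly (A F : Matrix (Fin p) (Fin q) ℝ) (c : 𝕂)
    (hγ : ∀ u, HasDerivAt (fun s => ((γ s u : ℝ) : 𝕂)) (v u) t) :
    HasLoopDerivAt (fun s => Ly A F c (γ s)) ((L₂ F c)⁻¹ * laxVar A F c (γ t) v) t :=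
  (hasLoopDerivAt_L₁ A F c hγ).const_mul _

lemma hasDerivAt_coordLine (x : Phase p q) (u u' : Coord p q) :
    HasDerivAt (fun ε : ℝ => (((x + ε • Pi.single u 1 : Phase p q) u' : ℝ) : 𝕂))
      ((Pi.single u 1 : Coord p q → 𝕂) u') 0 := by
  have h : HasDerivAt (fun ε : ℝ => x u' + ε * (Pi.single u (1 : ℝ) : Phase p q) u')
      ((Pi.single u (1 : ℝ) : Phase p q) u') 0 := by
    simpa using ((hasDerivAt_id (0 : ℝ)).mul_const _).const_add (x u')
  have h2 := (RCLike.ofRealCLM (K := 𝕂)).hasFDerivAt.comp_hasDerivAt (0 : ℝ) h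
  have h3 : (Pi.single u 1 : Coord p q → 𝕂) u' =
      RCLike.ofRealCLM (K := 𝕂) ((Pi.single u (1 : ℝ) : Phase p q) u') := by
    by_cases hu : u' = u
    · subst hu; simp
    · simp [hu]
  rw [h3]
  exact h2

lemma hasLoopDerivAt_Ly_line (A F : Matrix (Fin p) (Fin q) ℝ) (c : 𝕂) (x : Phase p q)
    (u : Coord p q) :
    HasLoopDerivAt (fun ε : ℝ => Ly A F c (x + ε • Pi.single u 1))
      ((L₂ F c)⁻¹ * laxVar A F c x (Pi.single u 1)) 0 := by
  simpa using hasLoopDerivAt_Ly A F c (hasDerivAt_coordLine (𝕂 := 𝕂) x u)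

lemma partialDeriv_coord (x : Phase p q) (u v : Coord p q) :
    partialDeriv (fun z => ((z u : ℝ) : 𝕂)) x v = (Pi.single v 1 : Coord p q → 𝕂) u :=
  (hasDerivAt_coordLine x v u).deriv

lemma partialDeriv_Ly_coeff (A F : Matrix (Fin p) (Fin q) ℝ) (c : 𝕂) (x : Phase p q)
    (d : ℤ) (i j : Fin p ⊕ Fin q) (u : Coord p q) :
    partialDeriv (fun z => (Ly A F c z).coeff d i j) x u =
      Loop.coeff ((L₂ F c)⁻¹ * laxVar A F c x (Pi.single u 1)) d i j :=
  ((hasLoopDerivAt_Ly_line A F c x u).coeff d i j).deriv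

/-- The Hamiltonian vector field of a function with partial derivatives `h`. -/
noncomputable def hamField (x : Phase p q) (h : Coord p q → 𝕂) (u : Coord p q) : 𝕂 :=
  ∑ v, ((poissonTensor x u v : ℝ) : 𝕂) * h v

lemma poissonBracket_eq (f g : Phase p q → 𝕂) (x : Phase p q) :
    poissonBracket f g x = ∑ u, hamField x (partialDeriv g x) u * partialDeriv f x u := by
  simp only [poissonBracket, hamField, Finset.sum_mul]
  exact Finset.sum_congr rfl fun u _ => Finset.sum_congr rfl fun v _ => by ring

lemma poissonBracket_coord (g : Phase p q → 𝕂) (x : Phase p q) (u : Coord p q) :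
    poissonBracket (fun z => ((z u : ℝ) : 𝕂)) g x = hamField x (partialDeriv g x) u := by
  simp [poissonBracket_eq, partialDeriv_coord, Pi.single_apply]

lemma linearMap_apply_eq_sum {E : Type*} [AddCommGroup E] [Module 𝕂 E]
    (f : (Coord p q → 𝕂) →ₗ[𝕂] E) (v : Coord p q → 𝕂) :
    f v = ∑ u, v u • f (Pi.single u 1) := by
  conv_lhs => rw [pi_eq_sum_univ' v]
  simp only [map_sum, map_smul]

lemma poissonBracket_Ly_coeff (A F : Matrix (Fin p) (Fin q) ℝ) (c : 𝕂) (g : Phase p q → 𝕂)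
    (x : Phase p q) (d : ℤ) (i j : Fin p ⊕ Fin q) :
    poissonBracket (fun z => (Ly A F c z).coeff d i j) g x =
      Loop.coeff ((L₂ F c)⁻¹ * laxVar A F c x (hamField x (partialDeriv g x))) d i j := by
  rw [poissonBracket_eq, linearMap_apply_eq_sum (laxVar A F c x), Finset.mul_sum]
  simp only [loop_mul_smul, partialDeriv_Ly_coeff]
  simp [Loop.coeff, Matrix.sum_apply, HahnSeries.coeff_sum]

lemma sum_coord {E : Type*} [AddCommMonoid E] (f : Coord p q → E) :
    ∑ u, f u = ((∑ i, ∑ j, f (.k i j)) + ∑ i, ∑ j, f (.l i j)) +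
      ((∑ i, ∑ j, f (.r i j)) + ∑ i, ∑ j, f (.m i j)) := by
  let e : ((Fin p × Fin p) ⊕ (Fin p × Fin p)) ⊕ ((Fin q × Fin q) ⊕ (Fin q × Fin q)) ≃ Coord p q :=
    { toFun := Sum.elim (Sum.elim (fun a => .k a.1 a.2) (fun a => .l a.1 a.2))
        (Sum.elim (fun a => .r a.1 a.2) (fun a => .m a.1 a.2))
      invFun := fun u => match u with
        | .k i j => .inl (.inl (i, j))
        | .l i j => .inl (.inr (i, j))
        | .r i j => .inr (.inl (i, j))
        | .m i j => .inr (.inr (i, j))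
      left_inv := by rintro ((⟨i, j⟩ | ⟨i, j⟩) | (⟨i, j⟩ | ⟨i, j⟩)) <;> rfl
      right_inv := by rintro (_ | _ | _ | _) <;> rfl }
  rw [← Equiv.sum_comp e]
  simp [e, Fintype.sum_sum_type, Fintype.sum_prod_type]

lemma ofReal_δ {n : ℕ} (i j : Fin n) : ((δ i j : ℝ) : 𝕂) = if i = j then 1 else 0 := by
  rw [δ]; split_ifs <;> simp

/-- The components of the field lie in `𝕂`, as `H` may be complex valued. All matrix entries count
as independent coordinates, so the derivative in the momenta enters through its skew part. -/
lemma baseMat_hamField (x : Phase p q) (h : Coord p q → 𝕂) :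
    baseMat (hamField x h) = baseMat (castPhase 𝕂 x) * ((momMat h)ᵀ - momMat h) := by
  ext (i | i) (j | j) <;>
  simp [baseMat, momMat, hamField, sum_coord, poissonTensor, ofReal_δ, Matrix.mul_apply, castPhase,
    Phase.k, Phase.r, sub_mul, mul_sub, Finset.sum_sub_distrib, ite_mul]

lemma momMat_hamField (x : Phase p q) (h : Coord p q → 𝕂) :
    momMat (hamField x h) =
      momMat (castPhase 𝕂 x) * (momMat h)ᵀ - (momMat (castPhase 𝕂 x) * (momMat h)ᵀ)ᵀ
      + (momMat (castPhase 𝕂 x) * momMat h)ᵀ - momMat (castPhase 𝕂 x) * momMat h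
      + ((baseMat (castPhase 𝕂 x))ᵀ * baseMat h - ((baseMat (castPhase 𝕂 x))ᵀ * baseMat h)ᵀ) := by
  ext (i | i) (j | j) <;>
  simp [baseMat, momMat, hamField, sum_coord, poissonTensor, ofReal_δ, Matrix.mul_apply, castPhase,
    Phase.k, Phase.r, Phase.l, Phase.m, sub_mul, add_mul, Finset.sum_sub_distrib,
    Finset.sum_add_distrib, ite_mul] <;>
  simp only [RCLike.algebraMap_eq_ofReal, mul_comm (h _)] <;> ring

end PhaseDerivative

/-! ### The twisted loop algebra and its projections. -/

section LoopAlgebra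

variable {p q : ℕ} {𝕂 : Type*} [RCLike 𝕂]

lemma coeff_mono_mul (e : ℤ) (B : Mat 𝕂 p q) (X : Loop 𝕂 p q) (d : ℤ) :
    Loop.coeff (mono e B * X) d = B * X.coeff (d - e) := by
  ext i j
  simp only [Loop.coeff, mono, Matrix.of_apply, Matrix.mul_apply, HahnSeries.coeff_sum]
  refine Finset.sum_congr rfl fun k _ => ?_
  rw [show -d = -(d - e) + -e by ring, HahnSeries.coeff_single_mul_add]

lemma coeff_mul_mono (e : ℤ) (B : Mat 𝕂 p q) (X : Loop 𝕂 p q) (d : ℤ) :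
    Loop.coeff (X * mono e B) d = X.coeff (d - e) * B := by
  ext i j
  simp only [Loop.coeff, mono, Matrix.of_apply, Matrix.mul_apply, HahnSeries.coeff_sum]
  refine Finset.sum_congr rfl fun k _ => ?_
  rw [show -d = -(d - e) + -e by ring, HahnSeries.coeff_mul_single_add]

lemma coeff_mono (e : ℤ) (B : Mat 𝕂 p q) (d : ℤ) :
    (mono e B).coeff d = if d = e then B else 0 := by
  ext i j
  by_cases h : d = e <;> simp [Loop.coeff, mono, h]

lemma trace_coeff_zero (X : Loop 𝕂 p q) : X.trace.coeff 0 = (X.coeff 0).trace := by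
  simp [Matrix.trace, Loop.coeff, HahnSeries.coeff_sum]

lemma pairing_mono (X : Loop 𝕂 p q) (e : ℤ) (B : Mat 𝕂 p q) :
    pairing X (mono e B) = -(1 / 2) * (X.coeff (-e) * B).trace := by
  rw [pairing, trace_coeff_zero, coeff_mul_mono, zero_sub]

lemma pairing_add (X Y Z : Loop 𝕂 p q) : pairing X (Y + Z) = pairing X Y + pairing X Z := by
  simp only [pairing, mul_add, Matrix.trace_add, HahnSeries.coeff_add]

/-- Monomials suffice as test loops: each isolates one coefficient, and the trace form on matrices
is nondegenerate. -/
lemma pairing_left_injective {X X' : Loop 𝕂 p q} (h : ∀ Y, pairing X Y = pairing X' Y) :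
    X = X' := by
  refine loop_ext fun d => Matrix.ext_iff_trace_mul_right.2 fun B => ?_
  have h1 := h (mono (-d) B)
  rw [pairing_mono, pairing_mono, neg_neg] at h1
  exact mul_left_cancel₀ (by norm_num) h1

/-- The involution matrix `diag(1, -1)` of the symmetric pair. -/
noncomputable def J : Mat 𝕂 p q := Matrix.fromBlocks 1 0 0 (-1)

lemma J_mul_J : (J : Mat 𝕂 p q) * J = 1 := by
  simp [J, Matrix.fromBlocks_multiply]

/-- Conjugation by `diag(1, -1)`. -/
noncomputable def jConj : Mat 𝕂 p q →ₐ[𝕂] Mat 𝕂 p q :=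
  AlgHom.ofLinearMap ((LinearMap.mulLeft 𝕂 J).comp (LinearMap.mulRight 𝕂 J))
    (by simp [J_mul_J]) fun X Y => by
      simp only [LinearMap.comp_apply, LinearMap.mulLeft_apply, LinearMap.mulRight_apply, mul_assoc]
      rw [← mul_assoc J J, J_mul_J, one_mul]

lemma jConj_apply (X : Mat 𝕂 p q) : jConj X = J * X * J := (mul_assoc _ _ _).symm

lemma J_transpose : (J : Mat 𝕂 p q)ᵀ = J := by simp [J, Matrix.fromBlocks_transpose]

lemma jConj_transpose (X : Mat 𝕂 p q) : jConj Xᵀ = (jConj X)ᵀ := by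
  simp [jConj_apply, Matrix.transpose_mul, J_transpose, mul_assoc]

lemma jConj_jConj (X : Mat 𝕂 p q) : jConj (jConj X) = X := by
  simp only [jConj_apply, mul_assoc, J_mul_J, mul_one]
  rw [← mul_assoc, J_mul_J, one_mul]

lemma jConj_fromBlocks (X : Matrix (Fin p) (Fin p) 𝕂) (Y : Matrix (Fin p) (Fin q) 𝕂)
    (Z : Matrix (Fin q) (Fin p) 𝕂) (W : Matrix (Fin q) (Fin q) 𝕂) :
    jConj (Matrix.fromBlocks X Y Z W) = Matrix.fromBlocks X (-Y) (-Z) W := by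
  simp [jConj_apply, J, Matrix.fromBlocks_multiply]

/-- The projection is the average over the group of order four generated by the commuting
involutions `X(λ) ↦ J X(-λ) J` and `X(λ) ↦ -X(-λ)ᵀ`, written in degree `d`. This replaces block
computations by equivariance. -/
lemma cartanProj_eq (d : ℤ) (X : Mat 𝕂 p q) :
    cartanProj d X = (1 / 4 : 𝕂) •
      (X + (-1 : 𝕂) ^ d • jConj X - (-1 : 𝕂) ^ d • Xᵀ - (jConj X)ᵀ) := by
  rw [← Matrix.fromBlocks_toBlocks X]
  simp only [Matrix.fromBlocks_transpose, jConj_fromBlocks]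
  rcases Int.even_or_odd d with h | h
  · rw [h.neg_one_zpow]
    simp only [cartanProj, LinearMap.coe_mk, AddHom.coe_mk, if_pos h]
    ext (i | i) (j | j) <;> simp <;> ring
  · rw [h.neg_one_zpow]
    simp only [cartanProj, LinearMap.coe_mk, AddHom.coe_mk, if_neg (Int.not_even_iff_odd.2 h)]
    ext (i | i) (j | j) <;> simp <;> ring

/-- `P` is a possible coefficient of `λ ^ e` in the twisted loop algebra. -/
def IsTwisted (e : ℤ) (P : Mat 𝕂 p q) : Prop :=
  jConj P = (-1 : 𝕂) ^ e • P ∧ Pᵀ = -((-1 : 𝕂) ^ e • P)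

/-- `S` is a possible coefficient of `λ ^ g` in a loop with `Sᵀ(-λ) = J S(-λ) J = S(λ)`. -/
def IsCotwisted (g : ℤ) (S : Mat 𝕂 p q) : Prop :=
  jConj S = (-1 : 𝕂) ^ g • S ∧ Sᵀ = (-1 : 𝕂) ^ g • S

lemma neg_one_zpow_eq_or' (d : ℤ) : (-1 : 𝕂) ^ d = 1 ∨ (-1 : 𝕂) ^ d = -1 := by
  rcases Int.even_or_odd d with h | h
  · exact Or.inl h.neg_one_zpow
  · exact Or.inr h.neg_one_zpow

/-- Transposition reverses the triple products, exchanging `P X S` and `S X P`; the resulting sign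
is absorbed because `P` is odd and `S` even under the twisted transpose. Thus the bracket is
equivariant under both involutions. -/
lemma cartanProj_bracket {d e f g : ℤ} (hd : d = e + f + g) {P S : Mat 𝕂 p q}
    (hP : IsTwisted e P) (hS : IsCotwisted g S) (X : Mat 𝕂 p q) :
    cartanProj d (P * X * S - S * X * P) =
      P * cartanProj f X * S - S * cartanProj f X * P := by
  have h0 : (-1 : 𝕂) ^ d = (-1) ^ e * (-1) ^ f * (-1) ^ g := by
    rw [hd, zpow_add₀ (by norm_num), zpow_add₀ (by norm_num)]
  simp only [cartanProj_eq, h0, mul_sub, sub_mul, Matrix.transpose_mul,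
    Matrix.transpose_smul, map_mul, map_sub, hP.1, hP.2, hS.1, hS.2, Matrix.mul_smul,
    Matrix.smul_mul, mul_neg, neg_mul]
  rcases neg_one_zpow_eq_or' (𝕂 := 𝕂) e with he | he <;>
  rcases neg_one_zpow_eq_or' (𝕂 := 𝕂) f with hf | hf <;>
  rcases neg_one_zpow_eq_or' (𝕂 := 𝕂) g with hg | hg <;>
  simp only [he, hf, hg, one_smul, neg_smul, mul_one, mul_neg, neg_mul, neg_neg, mul_add, add_mul,
    ← mul_assoc] <;>
  module

lemma isTwisted_fromBlocks_odd {e : ℤ} (he : Odd e) (S : Matrix (Fin p) (Fin q) 𝕂) :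
    IsTwisted e (Matrix.fromBlocks 0 S Sᵀ 0) := by
  constructor
  · rw [jConj_fromBlocks, he.neg_one_zpow]
    simp [Matrix.fromBlocks_neg]
  · rw [he.neg_one_zpow, Matrix.fromBlocks_transpose]
    simp

lemma IsTwisted.sub {e : ℤ} {P Q : Mat 𝕂 p q} (hP : IsTwisted e P) (hQ : IsTwisted e Q) :
    IsTwisted e (P - Q) := by
  refine ⟨?_, ?_⟩
  · rw [map_sub, hP.1, hQ.1, smul_sub]
  · rw [Matrix.transpose_sub, hP.2, hQ.2, smul_sub]; abel

/-- The coefficient of `λ ^ d` in `L₁ Q L₂ - L₂ Q L₁` for `L₁ = λ a + b + λ⁻¹ s` and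
`L₂ = 1 - λ⁻¹ y`. -/
def laxBracketCoeff (a b s y : Mat 𝕂 p q) (Q : ℤ → Mat 𝕂 p q) (d : ℤ) : Mat 𝕂 p q :=
  (a * Q (d - 1) * 1 - 1 * Q (d - 1) * a) + (b * Q d * 1 - 1 * Q d * b) +
    (s * Q (d + 1) * 1 - 1 * Q (d + 1) * s) - (a * Q d * y - y * Q d * a) -
    (b * Q (d + 1) * y - y * Q (d + 1) * b) - (s * Q (d + 2) * y - y * Q (d + 2) * s)

lemma laxBracketCoeff_add (a b s y : Mat 𝕂 p q) (Q Q' : ℤ → Mat 𝕂 p q) (d : ℤ) :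
    laxBracketCoeff a b s y (fun e => Q e + Q' e) d =
      laxBracketCoeff a b s y Q d + laxBracketCoeff a b s y Q' d := by
  simp only [laxBracketCoeff, mul_add, add_mul]
  abel

lemma coeff_laxBracket (a b s y : Mat 𝕂 p q) (Q : Loop 𝕂 p q) (d : ℤ) :
    Loop.coeff ((mono 1 a + mono 0 b + mono (-1) s) * Q * oneSub y -
      oneSub y * Q * (mono 1 a + mono 0 b + mono (-1) s)) d =
      laxBracketCoeff a b s y Q.coeff d := by
  simp only [oneSub, add_mul, mul_add, sub_mul, mul_sub, mul_one, one_mul, coeff_sub, coeff_add,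
    coeff_mul_mono, coeff_mono_mul, laxBracketCoeff]
  simp only [sub_zero, sub_neg_eq_add, sub_add_cancel, add_assoc, Int.reduceAdd]
  abel_nf

lemma cartanProj_laxBracketCoeff {a b s y : Mat 𝕂 p q} (ha : IsTwisted 1 a) (hb : IsTwisted 0 b)
    (hs : IsTwisted (-1) s) (hy : IsCotwisted (-1) y) (Q : ℤ → Mat 𝕂 p q) (d : ℤ) :
    cartanProj d (laxBracketCoeff a b s y Q d) =
      laxBracketCoeff a b s y (fun e => cartanProj e (Q e)) d := by
  have h1 : IsCotwisted 0 (1 : Mat 𝕂 p q) := by simp [IsCotwisted]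
  simp only [laxBracketCoeff]
  rw [map_sub, map_sub, map_sub, map_add, map_add,
    cartanProj_bracket (f := d - 1) (by ring) ha h1, cartanProj_bracket (f := d) (by ring) hb h1,
    cartanProj_bracket (f := d + 1) (by ring) hs h1, cartanProj_bracket (f := d) (by ring) ha hy,
    cartanProj_bracket (f := d + 1) (by ring) hb hy,
    cartanProj_bracket (f := d + 2) (by ring) hs hy]

lemma coeff_PPlus (X : Loop 𝕂 p q) (d : ℤ) :
    (PPlus 𝕂 p q X).coeff d = if 1 ≤ d then cartanProj d (X.coeff d) else 0 := by
  have h1 : PPlus 𝕂 p q X ∈ loopPlus 𝕂 p q := Submodule.projection_apply_mem _ X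
  have h2 : X - PPlus 𝕂 p q X ∈ loopMinus 𝕂 p q := Submodule.sub_projection_mem _ X
  have h1 := h1 d
  have h2 := h2 d
  split_ifs at h1 ⊢ with hd
  · have h2 := h2 hd
    rw [coeff_sub, map_sub, h1, sub_eq_zero] at h2
    exact h2.symm
  · exact h1

/-- The `λ ^ d` coefficients of `L₁ P_+(Z) L₂ - L₂ P_+(Z) L₁` when `L₁ Z L₂ = L₂ Z L₁`. -/
lemma laxBracketCoeff_PPlus {a b s y : Mat 𝕂 p q} (ha : IsTwisted 1 a) (hb : IsTwisted 0 b)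
    (hs : IsTwisted (-1) s) (hy : IsCotwisted (-1) y) {Z : Loop 𝕂 p q}
    (hZ : ∀ d, laxBracketCoeff a b s y Z.coeff d = 0) (d : ℤ) :
    laxBracketCoeff a b s y (PPlus 𝕂 p q Z).coeff d = -laxBracketCoeff a b s y
      (fun e => if 1 ≤ e then 0 else cartanProj e (Z.coeff e)) d := by
  -- Both truncations are moved inside the projections, so that the equivariance applies and the two
  -- pieces add up to `Z`.
  have h1 : (PPlus 𝕂 p q Z).coeff =
      fun e => cartanProj e (if 1 ≤ e then Z.coeff e else 0) := by
    funext e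
    rw [coeff_PPlus]
    split_ifs <;> simp
  have h2 : (fun e => if 1 ≤ e then 0 else cartanProj e (Z.coeff e)) =
      fun e => cartanProj e (if 1 ≤ e then 0 else Z.coeff e) := by
    funext e
    split_ifs <;> simp
  rw [h1, h2, ← cartanProj_laxBracketCoeff ha hb hs hy, ← cartanProj_laxBracketCoeff ha hb hs hy,
    ← map_neg]
  congr 1
  rw [eq_neg_iff_add_eq_zero, ← laxBracketCoeff_add]
  refine Eq.trans ?_ (hZ d)
  congr 1
  funext e
  split_ifs <;> simp

end LoopAlgebra

/-! ### The Hamiltonian vector field on `a` and `l`. -/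

section Field

variable {p q : ℕ} {𝕂 : Type*} [RCLike 𝕂]

/-- The block diagonal part. -/
noncomputable def diagPart (X : Mat 𝕂 p q) : Mat 𝕂 p q := (1 / 2 : 𝕂) • (X + jConj X)

/-- Variations of `diag(k, r)` and `diag(ℓ, m)` are block diagonal, so testing against them detects
only the block diagonal part of a gradient. -/
lemma eq_diagPart_of_trace {X Y : Mat 𝕂 p q} (hX : jConj X = X)
    (h : ∀ B : Mat 𝕂 p q, jConj B = B → (X * B).trace = (Y * B).trace) : X = diagPart Y := by
  have h2 : ∀ X B : Mat 𝕂 p q, (jConj X * B).trace = (X * jConj B).trace := fun X B => by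
    simp only [jConj_apply, mul_assoc]
    rw [Matrix.trace_mul_comm]
    simp only [mul_assoc]
  refine Matrix.ext_iff_trace_mul_right.2 fun B => ?_
  have h1 := h (B + jConj B) (by rw [map_add, jConj_jConj, add_comm])
  rw [mul_add, mul_add, Matrix.trace_add, Matrix.trace_add, ← h2, ← h2, hX] at h1
  rw [diagPart, Matrix.smul_mul, add_mul, Matrix.trace_smul, Matrix.trace_add, ← h1, smul_eq_mul]
  ring

lemma jConj_baseMat (v : Coord p q → 𝕂) : jConj (baseMat v) = baseMat v := by
  simp [baseMat, jConj_fromBlocks]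

lemma jConj_momMat (v : Coord p q → 𝕂) : jConj (momMat v) = momMat v := by
  simp [momMat, jConj_fromBlocks]

lemma eq_fromBlocks_of_jConj {B : Mat 𝕂 p q} (hB : jConj B = B) :
    B = Matrix.fromBlocks B.toBlocks₁₁ 0 0 B.toBlocks₂₂ := by
  rw [← Matrix.fromBlocks_toBlocks B, jConj_fromBlocks, Matrix.fromBlocks_inj] at hB
  conv_lhs => rw [← Matrix.fromBlocks_toBlocks B]
  rw [Matrix.fromBlocks_inj]
  refine ⟨rfl, ?_, ?_, rfl⟩ <;> ext i j
  · exact self_eq_neg.1 (congrFun (congrFun hB.2.1 i) j).symm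
  · exact self_eq_neg.1 (congrFun (congrFun hB.2.2.1 i) j).symm

lemma exists_baseMat_eq {B : Mat 𝕂 p q} (hB : jConj B = B) :
    ∃ w : Coord p q → 𝕂, baseMat w = B ∧ momMat w = 0 := by
  refine ⟨fun u => match u with
    | .k i j => B.toBlocks₁₁ i j
    | .r i j => B.toBlocks₂₂ i j
    | _ => 0, ?_, ?_⟩
  · rw [eq_fromBlocks_of_jConj hB]; rfl
  · ext (i | i) (j | j) <;> simp [momMat]

lemma exists_momMat_eq {B : Mat 𝕂 p q} (hB : jConj B = B) :
    ∃ w : Coord p q → 𝕂, baseMat w = 0 ∧ momMat w = B := by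
  refine ⟨fun u => match u with
    | .l i j => B.toBlocks₁₁ i j
    | .m i j => B.toBlocks₂₂ i j
    | _ => 0, ?_, ?_⟩
  · ext (i | i) (j | j) <;> simp [baseMat]
  · rw [eq_fromBlocks_of_jConj hB]; rfl

lemma sum_coord_mul (h w : Coord p q → 𝕂) :
    ∑ u, w u * h u =
      ((baseMat h)ᵀ * baseMat w).trace + ((momMat h)ᵀ * momMat w).trace := by
  have hT : ∀ X Y : Mat 𝕂 p q, (Xᵀ * Y).trace = ∑ i, ∑ j, Y i j * X i j := fun X Y => by
    simp only [Matrix.trace, Matrix.diag, Matrix.mul_apply, Matrix.transpose_apply]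
    rw [Finset.sum_comm]
    exact Finset.sum_congr rfl fun _ _ => Finset.sum_congr rfl fun _ _ => mul_comm _ _
  rw [sum_coord, hT, hT]
  simp [baseMat, momMat, Fintype.sum_sum_type]
  ring

lemma trace_mul_add_transpose (X Y B : Mat 𝕂 p q) :
    (X * (B * Y + Y * Bᵀ)).trace = ((Y * X + (X * Y)ᵀ) * B).trace := by
  have h1 : (X * (B * Y)).trace = (Y * X * B).trace := by
    rw [← mul_assoc, Matrix.trace_mul_comm, mul_assoc]
  have h2 : (X * (Y * Bᵀ)).trace = ((X * Y)ᵀ * B).trace := by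
    rw [← Matrix.trace_transpose, Matrix.transpose_mul, Matrix.transpose_mul,
      Matrix.transpose_transpose, mul_assoc, Matrix.trace_mul_comm, Matrix.transpose_mul]
  rw [mul_add, add_mul, Matrix.trace_add, Matrix.trace_add, h1, h2]

/-- The anticommutator with `y` is self-adjoint for the trace form, so the correction in `L₁` passes
from the variation of `a` to its gradient. -/
lemma trace_mul_sub_anticomm (Z₀ Z₁ y D E : Mat 𝕂 p q) :
    (Z₁ * D).trace + (Z₀ * (E - (1 / 2 : 𝕂) • (y * D + D * y))).trace =
      ((Z₁ - (1 / 2 : 𝕂) • (Z₀ * y + y * Z₀)) * D).trace + (Z₀ * E).trace := by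
  have h1 : (Z₀ * (D * y)).trace = (y * Z₀ * D).trace := by
    rw [← mul_assoc, Matrix.trace_mul_comm, mul_assoc]
  simp only [mul_sub, sub_mul, Matrix.mul_smul, Matrix.smul_mul, mul_add, add_mul,
    Matrix.trace_sub, Matrix.trace_add, Matrix.trace_smul, h1, smul_eq_mul, mul_assoc]
  ring

variable {x : Phase p q}

lemma baseMat_transpose_mul (hx : x ∈ phaseSpace p q) :
    (baseMat (castPhase 𝕂 x))ᵀ * baseMat (castPhase 𝕂 x) = 1 := by
  rw [baseMat_castPhase, toK_transpose, ← toK_mul, Matrix.fromBlocks_transpose,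
    Matrix.fromBlocks_multiply]
  simp [hx.1, hx.2.2.2.1, Matrix.fromBlocks_one, toK_one]

lemma baseMat_mul_transpose (hx : x ∈ phaseSpace p q) :
    baseMat (castPhase 𝕂 x) * (baseMat (castPhase 𝕂 x))ᵀ = 1 :=
  mul_eq_one_comm.1 (baseMat_transpose_mul hx)

lemma momMat_transpose (hx : x ∈ phaseSpace p q) :
    (momMat (castPhase 𝕂 x))ᵀ = -momMat (castPhase 𝕂 x) := by
  rw [momMat_castPhase, toK_transpose, Matrix.fromBlocks_transpose, hx.2.2.1, hx.2.2.2.2.2,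
    ← toK_neg, Matrix.fromBlocks_neg]
  simp

lemma isTwisted_sMat {e : ℤ} (he : Odd e) (F : Matrix (Fin p) (Fin q) ℝ) :
    IsTwisted e (toK 𝕂 (sMat F)) := by
  have h : toK 𝕂 (sMat F) =
      Matrix.fromBlocks 0 (F.map fun b => (b : 𝕂)) (F.map fun b => (b : 𝕂))ᵀ 0 := by
    ext (i | i) (j | j) <;> simp [toK, sMat]
  rw [h]
  exact isTwisted_fromBlocks_odd he _

lemma isTwisted_aMat (A : Matrix (Fin p) (Fin q) ℝ) (x : Phase p q) :
    IsTwisted 1 (toK 𝕂 (aMat A x)) := by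
  obtain ⟨h1, h2⟩ := isTwisted_sMat (𝕂 := 𝕂) odd_one A
  rw [toK_aMat]
  constructor
  · rw [map_mul, map_mul, jConj_transpose, jConj_baseMat, h1]
    simp
  · rw [Matrix.transpose_mul, Matrix.transpose_mul, Matrix.transpose_transpose, h2]
    simp [mul_assoc]

lemma isTwisted_lMat (hx : x ∈ phaseSpace p q) : IsTwisted 0 (toK 𝕂 (lMat x)) := by
  rw [toK_lMat]
  constructor
  · rw [map_neg, map_mul, map_mul, jConj_transpose, jConj_baseMat, jConj_momMat]
    simp
  · simp only [Matrix.transpose_neg, Matrix.transpose_mul, Matrix.transpose_transpose,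
      momMat_transpose hx]
    simp [mul_assoc]

lemma isCotwisted_yMat (F : Matrix (Fin p) (Fin q) ℝ) (c : 𝕂) : IsCotwisted (-1) (yMat F c) := by
  have h : yMat F c = Matrix.fromBlocks 0 (c • F.map fun b => (b : 𝕂))
      (-(c • F.map fun b => (b : 𝕂))ᵀ) 0 := by
    ext (i | i) (j | j) <;> simp [yMat, toK]
  rw [h]
  constructor
  · rw [jConj_fromBlocks]
    simp [Matrix.fromBlocks_neg]
  · rw [Matrix.fromBlocks_transpose]
    simp [Matrix.fromBlocks_neg]

lemma isTwisted_lyMat (hx : x ∈ phaseSpace p q) (A F : Matrix (Fin p) (Fin q) ℝ) (c : 𝕂) :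
    IsTwisted 0 (lyMat A F c x) := by
  have ha := isTwisted_aMat (𝕂 := 𝕂) A x
  have hy := isCotwisted_yMat F c
  refine (isTwisted_lMat hx).sub ⟨?_, ?_⟩
  · rw [map_smul, map_add, map_mul, map_mul, ha.1, hy.1]
    simp
  · rw [Matrix.transpose_smul, Matrix.transpose_add, Matrix.transpose_mul, Matrix.transpose_mul,
      ha.2, hy.2]
    simp [add_comm]

/-- Since `y = c J s` and both `s` and `X` anticommute with `J`, the product `s X` commutes with
`J`, which can be pulled to the front. -/
lemma sMat_mul_yMat (F : Matrix (Fin p) (Fin q) ℝ) (c : 𝕂) {X : Mat 𝕂 p q}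
    (hX : jConj X = -X) :
    toK 𝕂 (sMat F) * X * yMat F c = yMat F c * X * toK 𝕂 (sMat F) := by
  have hy : yMat F c = c • (J * toK 𝕂 (sMat F)) := by
    ext (i | i) (j | j) <;> simp [yMat, toK, sMat, J, Matrix.mul_apply, Matrix.one_apply]
  have hs := (isTwisted_sMat (𝕂 := 𝕂) odd_one F).1
  have h : jConj (toK 𝕂 (sMat F) * X) = toK 𝕂 (sMat F) * X := by
    rw [map_mul, hs, hX]; simp
  have h2 : J * (toK 𝕂 (sMat F) * X) = toK 𝕂 (sMat F) * X * J := by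
    conv_rhs => rw [← h, jConj_apply, mul_assoc, J_mul_J, mul_one]
  rw [hy, Matrix.mul_smul, Matrix.smul_mul, Matrix.smul_mul, ← mul_assoc, ← h2]
  simp only [mul_assoc]

/-- The Hamiltonian vector field, at a point of the phase space, of a function whose differential
in the direction `w` is `-½ tr (Z₁ δa + Z₀ δ(l - ½ (y a + a y)))`. -/
lemma var_hamField (hx : x ∈ phaseSpace p q) (A F : Matrix (Fin p) (Fin q) ℝ) (c : 𝕂)
    {h : Coord p q → 𝕂} {Z₀ Z₁ : Mat 𝕂 p q}
    (hh : ∀ w, ∑ u, w u * h u =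
      -(1 / 2) * ((Z₁ * aVar A x w).trace + (Z₀ * lyVar A F c x w).trace)) :
    aVar A x (hamField x h) =
        cartanProj 0 Z₀ * toK 𝕂 (aMat A x) - toK 𝕂 (aMat A x) * cartanProj 0 Z₀ ∧
      lVar x (hamField x h) =
        (cartanProj (-1) Z₁ -
            (1 / 2 : 𝕂) • (yMat F c * cartanProj 0 Z₀ + cartanProj 0 Z₀ * yMat F c)) *
          toK 𝕂 (aMat A x) - toK 𝕂 (aMat A x) * (cartanProj (-1) Z₁ -
            (1 / 2 : 𝕂) • (yMat F c * cartanProj 0 Z₀ + cartanProj 0 Z₀ * yMat F c)) +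
        (cartanProj 0 Z₀ * toK 𝕂 (lMat x) - toK 𝕂 (lMat x) * cartanProj 0 Z₀) := by
  simp only [sum_coord_mul] at hh
  have hK := jConj_baseMat (castPhase 𝕂 x)
  have hKT : jConj (baseMat (castPhase 𝕂 x))ᵀ = (baseMat (castPhase 𝕂 x))ᵀ := by
    rw [jConj_transpose, hK]
  have hKK' := baseMat_mul_transpose (𝕂 := 𝕂) hx
  have hl := momMat_transpose (𝕂 := 𝕂) hx
  have haJ := (isTwisted_aMat (𝕂 := 𝕂) A x).1
  have haT := (isTwisted_aMat (𝕂 := 𝕂) A x).2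
  have hlJ := (isTwisted_lMat (𝕂 := 𝕂) hx).1
  have hlT := (isTwisted_lMat (𝕂 := 𝕂) hx).2
  have hyJ := (isCotwisted_yMat F c).1
  have hyT := (isCotwisted_yMat F c).2
  have haE := toK_aMat (𝕂 := 𝕂) A x
  have hlE := toK_lMat (𝕂 := 𝕂) x
  have hbase := baseMat_hamField (𝕂 := 𝕂) x h
  have hmom := momMat_hamField (𝕂 := 𝕂) x h
  simp only [aVar, lyVar, lVar] at hh ⊢
  set ξ := hamField x h
  generalize baseMat (castPhase 𝕂 x) = K at *
  generalize momMat (castPhase 𝕂 x) = l at *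
  generalize toK 𝕂 (sMat A) = A₀ at *
  generalize toK 𝕂 (aMat A x) = a at *
  generalize toK 𝕂 (lMat x) = l' at *
  generalize yMat F c = y at *
  simp only [zpow_one, zpow_zero, zpow_neg, inv_neg, inv_one, one_smul, neg_smul, neg_neg]
    at haJ haT hlJ hlT hyJ hyT
  -- The momentum gradient is read off from variations with `K` fixed, where only `l` moves.
  have hΛ : (momMat h)ᵀ = diagPart ((1 / 2 : 𝕂) • (Kᵀ * Z₀ * K)) := by
    refine eq_diagPart_of_trace (by rw [jConj_transpose, jConj_momMat]) fun B hB => ?_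
    obtain ⟨w, hw1, hw2⟩ := exists_momMat_eq hB
    have h1 := hh w
    rw [hw1, hw2] at h1
    simp only [Matrix.mul_zero, Matrix.zero_mul, Matrix.transpose_zero, Matrix.trace_zero,
      zero_add, add_zero, smul_zero, sub_zero, mul_neg, Matrix.trace_neg] at h1
    rw [h1, Matrix.smul_mul, Matrix.trace_smul, smul_eq_mul]
    have h2 : (Z₀ * (K * B * Kᵀ)).trace = (Kᵀ * Z₀ * K * B).trace := by
      rw [← mul_assoc, Matrix.trace_mul_comm]; simp only [mul_assoc]
    rw [h2]; ring
  have hΞ : K * (baseMat h)ᵀ = diagPart (-(1 / 2 : 𝕂) •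
      (a * (Z₁ - (1 / 2 : 𝕂) • (Z₀ * y + y * Z₀)) +
        ((Z₁ - (1 / 2 : 𝕂) • (Z₀ * y + y * Z₀)) * a)ᵀ + l' * Z₀ + (Z₀ * l')ᵀ)) := by
    refine eq_diagPart_of_trace (by rw [map_mul, jConj_transpose, jConj_baseMat, hK])
      fun B hB => ?_
    -- In the directions `B K` both `a` and `l` vary by `B · + · Bᵀ`. The transpose remains because
    -- partial derivatives are taken in the ambient space, where `B` need not be skew.
    obtain ⟨w, hw1, hw2⟩ := exists_baseMat_eq (B := B * K) (by rw [map_mul, hB, hK])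
    have h1 := hh w
    have ea : B * K * A₀ * Kᵀ + K * A₀ * (B * K)ᵀ = B * a + a * Bᵀ := by
      rw [haE, Matrix.transpose_mul]; simp only [mul_assoc]
    have el : -((B * K * l + K * 0) * Kᵀ + K * l * (B * K)ᵀ) = B * l' + l' * Bᵀ := by
      rw [hlE, Matrix.transpose_mul, mul_zero, add_zero, mul_neg, neg_mul, neg_add]
      simp only [mul_assoc]
    rw [hw1, hw2, ea, el, trace_mul_sub_anticomm, trace_mul_add_transpose,
      trace_mul_add_transpose, mul_zero, Matrix.trace_zero, add_zero] at h1
    rw [mul_assoc, Matrix.trace_mul_comm, mul_assoc, h1, Matrix.smul_mul, Matrix.trace_smul,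
      add_assoc (_ + _), add_mul _ (_ + _), Matrix.trace_add, smul_eq_mul]
  have hKKl : ∀ X, K * (Kᵀ * X) = X := fun X => by rw [← mul_assoc, hKK', one_mul]
  -- Angular velocity in the body frame: in the space frame it is `π_0 Z_0`.
  have hω : (momMat h)ᵀ - momMat h = Kᵀ * (cartanProj 0 Z₀ * K) := by
    rw [← Matrix.transpose_transpose (momMat h), hΛ, cartanProj_eq, diagPart]
    simp only [Matrix.mul_smul, Matrix.smul_mul, map_mul, map_smul, hK, hKT, Matrix.transpose_smul,
      Matrix.transpose_add, Matrix.transpose_mul, Matrix.transpose_transpose, zpow_zero, one_smul,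
      mul_add, add_mul, mul_sub, sub_mul, mul_assoc]
    module
  have hnT : (cartanProj 0 Z₀)ᵀ = -cartanProj 0 Z₀ := by
    rw [cartanProj_eq]
    simp only [zpow_zero, one_smul, Matrix.transpose_smul, Matrix.transpose_sub,
      Matrix.transpose_add, Matrix.transpose_transpose]
    module
  have hb : baseMat ξ = cartanProj 0 Z₀ * K := by rw [hbase, hω, hKKl]
  have hm : momMat ξ = l * (Kᵀ * (cartanProj 0 Z₀ * K)) - Kᵀ * (cartanProj 0 Z₀ * K) * l +
      (Kᵀ * baseMat h - (baseMat h)ᵀ * K) := by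
    rw [hmom, ← hω]
    simp only [Matrix.transpose_mul, Matrix.transpose_transpose, hl, mul_sub, sub_mul, mul_neg]
    abel
  constructor
  · rw [hb, haE, Matrix.transpose_mul, hnT]
    simp only [mul_assoc, mul_neg, sub_eq_add_neg]
  · have h1 : -((baseMat ξ * l + K * momMat ξ) * Kᵀ + K * l * (baseMat ξ)ᵀ) =
        K * (baseMat h)ᵀ - (K * (baseMat h)ᵀ)ᵀ := by
      rw [hb, hm, Matrix.transpose_mul, Matrix.transpose_mul, hnT, Matrix.transpose_transpose]
      simp only [mul_add, add_mul, mul_sub, sub_mul, mul_assoc, hKKl, hKK', mul_one, mul_neg]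
      abel
    rw [h1, hΞ, diagPart, cartanProj_eq, cartanProj_eq]
    simp only [zpow_zero, zpow_neg, zpow_one, inv_neg, inv_one, one_smul, neg_smul,
      Matrix.mul_smul, Matrix.smul_mul, map_mul, map_add, map_sub, map_neg, map_smul, mul_neg,
      neg_mul, neg_neg, Matrix.transpose_smul,
      Matrix.transpose_add, Matrix.transpose_sub, Matrix.transpose_neg,
      Matrix.transpose_mul, Matrix.transpose_transpose, mul_add, add_mul, mul_sub, sub_mul,
      jConj_transpose, haJ, haT, hlJ, hlT, hyJ, hyT, mul_assoc]
    module

end Field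

/-! ### The Lax equation and the Lax triad. -/

section LaxEquation

variable {p q : ℕ} {𝕂 : Type*} [RCLike 𝕂] {x : Phase p q}

/-- The Hamiltonian vector field acts on `L₁` by `L₁ M L₂ - L₂ M L₁`. -/
lemma laxVar_hamField (hx : x ∈ phaseSpace p q) (A F : Matrix (Fin p) (Fin q) ℝ) (c : 𝕂)
    {h : Coord p q → 𝕂} {Z : Loop 𝕂 p q} (hZ : L₁ A F c x * Z * L₂ F c = L₂ F c * Z * L₁ A F c x)
    (hh : ∀ u, h u = pairing Z (laxVar A F c x (Pi.single u 1))) :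
    laxVar A F c x (hamField x h) =
      L₁ A F c x * PPlus 𝕂 p q Z * L₂ F c - L₂ F c * PPlus 𝕂 p q Z * L₁ A F c x := by
  have ha := isTwisted_aMat (𝕂 := 𝕂) A x
  have hb := isTwisted_lyMat hx A F c
  have hs := isTwisted_sMat (𝕂 := 𝕂) (odd_neg_one : Odd (-1 : ℤ)) F
  have hy := isCotwisted_yMat F c
  have hZ0 : ∀ d, laxBracketCoeff (toK 𝕂 (aMat A x)) (lyMat A F c x) (toK 𝕂 (sMat F)) (yMat F c)
      Z.coeff d = 0 := fun d => by
    rw [← coeff_laxBracket, ← L₁_eq]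
    rw [L₂] at hZ
    rw [hZ, sub_self, coeff_zero]
  have hlin : ∀ w, ∑ u, w u * h u = pairing Z (laxVar A F c x w) := fun w => by
    let f : Loop 𝕂 p q →ₗ[𝕂] 𝕂 :=
      { toFun := pairing Z
        map_add' := pairing_add Z
        map_smul' := fun b Y => by
          rw [pairing, pairing, loop_mul_smul, trace_coeff_zero, trace_coeff_zero, coeff_smul,
            Matrix.trace_smul, RingHom.id_apply, smul_eq_mul, smul_eq_mul]
          ring }
    have h1 := linearMap_apply_eq_sum (f.comp (laxVar A F c x)) w
    simp only [LinearMap.comp_apply, smul_eq_mul] at h1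
    rw [show pairing Z (laxVar A F c x w) = f (laxVar A F c x w) from rfl, h1]
    exact Finset.sum_congr rfl fun u _ => by rw [hh u]; rfl
  -- The variation of `L₁` has only degrees `1` and `0`, which the pairing matches with degrees `-1`
  -- and `0` of `Z`.
  obtain ⟨h1, h2⟩ := var_hamField hx A F c (h := h) (Z₀ := Z.coeff 0) (Z₁ := Z.coeff (-1))
    fun w => by
      rw [hlin w]
      simp only [laxVar, LinearMap.coe_mk, AddHom.coe_mk]
      rw [pairing_add, pairing_mono, pairing_mono, neg_zero]
      ring
  refine loop_ext fun d => ?_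
  rw [L₁_eq, L₂, coeff_laxBracket]
  simp only [laxVar, LinearMap.coe_mk, AddHom.coe_mk, coeff_add, coeff_mono]
  -- In degrees `≥ 0` the complementary part of `Z` gives few terms; in negative degrees `P_+ Z`
  -- itself does.
  by_cases hd : 0 ≤ d
  · rw [laxBracketCoeff_PPlus ha hb hs hy hZ0]
    by_cases h3 : 2 ≤ d
    · simp [laxBracketCoeff, show d ≠ 1 by omega, show d ≠ 0 by omega, show (1 : ℤ) ≤ d by omega,
        show (1 : ℤ) ≤ d - 1 by omega, show (1 : ℤ) ≤ d + 1 by omega,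
        show (1 : ℤ) ≤ d + 2 by omega]
    · obtain rfl | rfl : d = 0 ∨ d = 1 := by omega
      · simp only [laxBracketCoeff, lyVar, h1, h2, lyMat]
        simp only [zero_ne_one, if_false, if_true, zero_add, zero_sub, Int.reduceLE, Int.reduceNeg,
          mul_zero, zero_mul, sub_zero, mul_one, one_mul, add_zero, mul_add, add_mul, mul_sub,
          sub_mul, Matrix.mul_smul, Matrix.smul_mul, mul_assoc]
        module
      · simp [laxBracketCoeff, h1]
  · have h4 : ∀ e ≤ 0, (PPlus 𝕂 p q Z).coeff e = 0 := fun e he => by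
      rw [coeff_PPlus, if_neg (by omega)]
    rw [if_neg (by omega), if_neg (by omega), laxBracketCoeff, h4 (d - 1) (by omega),
      h4 d (by omega), h4 (d + 1) (by omega)]
    -- The only possible negative-degree contribution is at `d = -1`, from the coefficient of `λ` in
    -- `P_+ Z`; that coefficient lies in `𝔭` and so anticommutes with `J`.
    have h5 : toK 𝕂 (sMat F) * (PPlus 𝕂 p q Z).coeff (d + 2) * yMat F c =
        yMat F c * (PPlus 𝕂 p q Z).coeff (d + 2) * toK 𝕂 (sMat F) := by
      by_cases h6 : d = -1
      · subst h6
        refine sMat_mul_yMat F c ?_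
        rw [coeff_PPlus, if_pos (by norm_num), cartanProj_eq]
        simp only [Int.reduceNeg, Int.reduceAdd, zpow_one, neg_smul, one_smul, map_smul, map_add,
          map_sub, map_neg, jConj_jConj, jConj_transpose]
        module
      · rw [h4 (d + 2) (by omega)]; simp
    rw [h5]
    simp

lemma L₂_mul_inv (F : Matrix (Fin p) (Fin q) ℝ) (c : 𝕂) : L₂ F c * (L₂ F c)⁻¹ = 1 :=
  Matrix.mul_nonsing_inv _ (isUnit_oneSub_det _)

lemma L₂_inv_mul (F : Matrix (Fin p) (Fin q) ℝ) (c : 𝕂) : (L₂ F c)⁻¹ * L₂ F c = 1 :=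
  Matrix.nonsing_inv_mul _ (isUnit_oneSub_det _)

lemma L₂_mul_Ly (A F : Matrix (Fin p) (Fin q) ℝ) (c : 𝕂) (x : Phase p q) :
    L₂ F c * Ly A F c x = L₁ A F c x := by
  rw [Ly, ← mul_assoc, L₂_mul_inv, one_mul]

/-- Right multiplication by `L₂` carries the splitting of `X L₂⁻¹` to the deformed splitting of `X`.
-/
lemma My_eq (F : Matrix (Fin p) (Fin q) ℝ) (c : 𝕂) (X : Loop 𝕂 p q) :
    My F c X = M F c X * L₂ F c := by
  have h1 : M F c X * L₂ F c ∈ loopPlusY (yMat F c) :=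
    Submodule.mem_map_of_mem (f := (mulOneSub (yMat F c)).toLinearMap)
      (Submodule.projection_apply_mem _ _)
  have h2 : X - M F c X * L₂ F c ∈ loopMinusY (yMat F c) := by
    have h3 := Submodule.mem_map_of_mem (f := (mulOneSub (yMat F c)).toLinearMap)
      (Submodule.sub_projection_mem (isCompl_loop (𝕂 := 𝕂) (p := p) (q := q)) (X * (L₂ F c)⁻¹))
    have h4 : (mulOneSub (yMat F c)).toLinearMap (X * (L₂ F c)⁻¹ - M F c X) =
        X - M F c X * L₂ F c := by
      change (X * (L₂ F c)⁻¹ - M F c X) * L₂ F c = _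
      rw [sub_mul, mul_assoc, L₂_inv_mul, mul_one]
    rw [← h4]
    exact h3
  have h5 : X = M F c X * L₂ F c + (X - M F c X * L₂ F c) := by abel
  rw [My, PPlusY]
  conv_lhs => rw [h5]
  rw [map_add, Submodule.projection_apply_of_mem_left _ h1,
    (Submodule.projection_apply_eq_zero_iff _).2 h2, add_zero]

/-- The coefficientwise derivative of a product with a constant loop. -/
lemma LoopHasDerivAt.const_mul {X : ℝ → Loop 𝕂 p q} {X' : Loop 𝕂 p q} {t : ℝ}
    (hX : LoopHasDerivAt X X' t) (a : ℤ) (ha : ∀ s d, a < d → (X s).coeff d = 0)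
    (Y : Loop 𝕂 p q) : LoopHasDerivAt (fun s => Y * X s) (Y * X') t := by
  have h : HasLoopDerivAt X X' t := fun i j =>
    ⟨⟨-a, fun s n hn => by
      have h1 := congrFun (congrFun (ha s (-n) (by omega)) i) j
      simpa [Loop.coeff] using h1⟩,
    fun n => by simpa [Loop.coeff] using hX (-n) i j⟩
  exact fun d i j => (h.const_mul Y).coeff d i j

lemma coeff_L₁_eq_zero (A F : Matrix (Fin p) (Fin q) ℝ) (c : 𝕂) (x : Phase p q) {d : ℤ}
    (hd : 1 < d) : (L₁ A F c x).coeff d = 0 := by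
  rw [L₁_eq, coeff_add, coeff_add, coeff_mono, coeff_mono, coeff_mono, if_neg (by omega),
    if_neg (by omega), if_neg (by omega), add_zero, add_zero]

lemma exists_coeff_eq_zero (X : Loop 𝕂 p q) : ∃ b : ℤ, ∀ d ≥ b, X.coeff d = 0 := by
  have h : ∀ᶠ d : ℤ in Filter.atTop, ∀ i j, (X i j).coeff (-d) = 0 := by
    simp only [Filter.eventually_all]
    intro i j
    filter_upwards [Filter.eventually_gt_atTop (-(X i j).order)] with d hd
    exact HahnSeries.coeff_eq_zero_of_lt_order (by omega)
  obtain ⟨b, hb⟩ := Filter.eventually_atTop.1 h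
  exact ⟨b, fun d hd => by ext i j; exact hb d hd i j⟩

/-- Since `L₂⁻¹` has no positive powers of `λ`, the bound on degrees is preserved. This makes the
bound for `L_y` uniform along an arbitrary curve, as the product rule requires. -/
lemma coeff_L₂_inv_mul_eq_zero (F : Matrix (Fin p) (Fin q) ℝ) (c : 𝕂) {X : Loop 𝕂 p q} {a : ℤ}
    (hX : ∀ d, a < d → X.coeff d = 0) :
    ∀ d, a < d → Loop.coeff ((L₂ F c)⁻¹ * X) d = 0 := by
  set Y : Loop 𝕂 p q := (L₂ F c)⁻¹ * X with hY
  have h1 : X = Y - mono (-1) (yMat F c) * Y := by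
    have h2 : L₂ F c * Y = X := by rw [hY, ← mul_assoc, L₂_mul_inv, one_mul]
    rw [← h2, L₂, oneSub, sub_mul, one_mul]
  have h2 : ∀ d, Y.coeff d = X.coeff d + yMat F c * Y.coeff (d + 1) := fun d => by
    conv_rhs => rw [h1]
    rw [coeff_sub, coeff_mono_mul, sub_neg_eq_add, sub_add_cancel]
  obtain ⟨b, hb⟩ := exists_coeff_eq_zero Y
  -- Descending induction: above `a` the recursion reads `Y_d = y Y_{d+1}`, starting from some bound
  -- `b` of `Y`.
  have h3 : ∀ n : ℕ, ∀ d, a < d → b - n ≤ d → Y.coeff d = 0 := by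
    intro n
    induction n with
    | zero => exact fun d _ hd => hb d (by simpa using hd)
    | succ n ih =>
      intro d hd hd'
      rw [h2, hX d hd, ih (d + 1) (by omega) (by push_cast at hd'; omega), mul_zero, add_zero]
  exact fun d hd => h3 (b - d).toNat d hd (by omega)

lemma laxEquationAt_iff (A F : Matrix (Fin p) (Fin q) ℝ) (c : 𝕂) (X : Loop 𝕂 p q)
    (γ : ℝ → Phase p q) (t : ℝ) : LaxEquationAt A F c X γ t ↔ LaxTriadAt A F c X γ t := by
  have hval : Ly A F c (γ t) * My F c X - My F c X * Ly A F c (γ t) = (L₂ F c)⁻¹ *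
      (L₁ A F c (γ t) * M F c X * L₂ F c - L₂ F c * M F c X * L₁ A F c (γ t)) := by
    rw [My_eq, mul_assoc (M F c X), L₂_mul_Ly, Ly, mul_sub, mul_assoc (L₂ F c),
      ← mul_assoc (L₂ F c)⁻¹ (L₂ F c), L₂_inv_mul, one_mul]
    simp only [mul_assoc]
  rw [LaxEquationAt, LaxTriadAt, hval]
  constructor
  · intro h
    refine ⟨?_, fun d i j => ?_⟩
    · have h1 := h.const_mul 1 (fun s => coeff_L₂_inv_mul_eq_zero F c fun d hd =>
        coeff_L₁_eq_zero A F c (γ s) hd) (L₂ F c)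
      rw [← mul_assoc, L₂_mul_inv, one_mul] at h1
      simpa only [L₂_mul_Ly] using h1
    · rw [sub_self]
      simpa using hasDerivAt_const t _
  · rintro ⟨h, -⟩
    exact h.const_mul 1 (fun s d hd => coeff_L₁_eq_zero A F c (γ s) hd) _

/-- The value of the Poisson bracket of the entries of `L_y` with `φ(L_y)`. -/
lemma poissonBracket_Ly_Ham {A F : Matrix (Fin p) (Fin q) ℝ} {c : 𝕂} {φ : Loop 𝕂 p q → 𝕂}
    (hx : x ∈ phaseSpace p q) {X : Loop 𝕂 p q} (hX : Commute X (Ly A F c x))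
    (hφ : ∀ u, partialDeriv (Ham A F c φ) x u =
      pairing X ((L₂ F c)⁻¹ * laxVar A F c x (Pi.single u 1))) :
    (L₂ F c)⁻¹ * laxVar A F c x (hamField x (partialDeriv (Ham A F c φ) x)) =
      Ly A F c x * My F c X - My F c X * Ly A F c x := by
  -- With `L₁ = L₂ L_y`, both sides equal `L₂ L_y X = L₂ X L_y`.
  have hZ : L₁ A F c x * (X * (L₂ F c)⁻¹) * L₂ F c = L₂ F c * (X * (L₂ F c)⁻¹) * L₁ A F c x := by
    rw [mul_assoc, mul_assoc, L₂_inv_mul, mul_one, mul_assoc, mul_assoc, ← L₂_mul_Ly, mul_assoc,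
      ← hX.eq, ← mul_assoc (L₂ F c)⁻¹, L₂_inv_mul, one_mul]
  rw [laxVar_hamField hx A F c hZ fun u => by rw [hφ u, pairing, pairing, mul_assoc],
    My_eq, mul_assoc (M F c X), L₂_mul_Ly, Ly, mul_sub, mul_assoc (L₂ F c),
    ← mul_assoc (L₂ F c)⁻¹ (L₂ F c), L₂_inv_mul, one_mul]
  simp only [mul_assoc, M]

/-- The gradient of a spectral invariant exists, commutes with the loop, and computes the
derivative of the invariant along real curves. -/
lemma IsSpectralInvariantAt.exists_gradient {φ : Loop 𝕂 p q → 𝕂} {L : Loop 𝕂 p q}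
    (hφ : IsSpectralInvariantAt φ L) : ∃ X, Commute X L ∧ IsGradientAt φ L X ∧
      ∀ (Y : ℝ → Loop 𝕂 p q) (Y' : Loop 𝕂 p q) (t : ℝ), HasLoopDerivAt Y Y' t → Y t = L →
        HasDerivAt (fun s => φ (Y s)) (pairing X Y') t := by
  obtain ⟨N, k, n, G, hG, rfl⟩ := hφ
  refine ⟨_, spectralGradient_commute k n
    (fun j => fderiv 𝕂 G (fun j => traceCoeff (k j) (n j) L) (Pi.single j 1)) L, ?_, ?_⟩
  · intro Y
    have h1 := (HasLoopDerivAt.line L Y).comp_spectral k n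
      (G := G) (G' := fderiv 𝕂 G (fun j => traceCoeff (k j) (n j) L))
      (by simpa only [zero_smul, add_zero] using hG.hasFDerivAt)
    rwa [zero_smul, add_zero] at h1
  · rintro Y Y' t hY rfl
    exact hY.comp_spectral k n hG.hasFDerivAt

end LaxEquation

end SpinTop

theorem mainTheorem2 {𝕂 : Type*} [RCLike 𝕂] {p q : ℕ}
    (A F : Matrix (Fin p) (Fin q) ℝ) (c : 𝕂)
    (φ : SpinTop.Loop 𝕂 p q → 𝕂)
    (x : SpinTop.Phase p q) (hx : x ∈ SpinTop.phaseSpace p q)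
    (hφ : SpinTop.IsSpectralInvariantAt φ (SpinTop.Ly A F c x)) :
    -- the gradient `dφ(L_y)` exists and is unique
    (∃! X, SpinTop.IsGradientAt φ (SpinTop.Ly A F c x) X) ∧
    ∀ X, SpinTop.IsGradientAt φ (SpinTop.Ly A F c x) X →
      -- `M_y = P_+^y(dφ(L_y)) = M (1 - λ⁻¹ y)`
      SpinTop.My F c X = SpinTop.M F c X * SpinTop.L₂ F c ∧
      -- the Hamiltonian vector field of `H` acts on `L_y` by the commutator with `M_y`
      (∀ d i j,
        SpinTop.poissonBracket (fun z => (SpinTop.Ly A F c z).coeff d i j)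
            (SpinTop.Ham A F c φ) x =
          SpinTop.Loop.coeff (SpinTop.Ly A F c x * SpinTop.My F c X -
            SpinTop.My F c X * SpinTop.Ly A F c x) d i j) ∧
      ∀ (γ : ℝ → SpinTop.Phase p q) (t : ℝ), γ t = x →
        -- Hamilton's equations give rise to the Lax equation
        (SpinTop.IsHamiltonianAt (SpinTop.Ham A F c φ) γ t →
          SpinTop.LaxEquationAt A F c X γ t) ∧
        -- the Hamiltonian evolution of the entries of `L_y` is equivalent to the Lax equation
        ((∀ d i j, HasDerivAt (fun s => (SpinTop.Ly A F c (γ s)).coeff d i j)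
            (SpinTop.poissonBracket (fun z => (SpinTop.Ly A F c z).coeff d i j)
              (SpinTop.Ham A F c φ) x) t) ↔
          SpinTop.LaxEquationAt A F c X γ t) ∧
        -- the Lax equation is equivalent to the Lax triad for the pair `L₁`, `L₂`
        (SpinTop.LaxEquationAt A F c X γ t ↔ SpinTop.LaxTriadAt A F c X γ t) := by
  obtain ⟨X₀, hcomm, hgrad, hcurve⟩ := hφ.exists_gradient
  have huniq : ∀ X, SpinTop.IsGradientAt φ (SpinTop.Ly A F c x) X → X = X₀ := fun X hX =>
    SpinTop.pairing_left_injective fun Y => (hX Y).unique (hgrad Y)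
  refine ⟨⟨X₀, hgrad, huniq⟩, fun X hX => ?_⟩
  obtain rfl := huniq X hX
  -- Partial derivatives of `H` are along real lines whose image in loops is curved, so the chain
  -- rule along curves is needed, beyond the directional definition of the gradient.
  have hpart : ∀ u, SpinTop.partialDeriv (SpinTop.Ham A F c φ) x u =
      SpinTop.pairing X ((SpinTop.L₂ F c)⁻¹ * SpinTop.laxVar A F c x (Pi.single u 1)) := fun u =>
    (hcurve _ _ 0 (SpinTop.hasLoopDerivAt_Ly_line A F c x u) (by simp)).deriv
  have hbr := SpinTop.poissonBracket_Ly_Ham hx hcomm hpart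
  have hbr' := SpinTop.poissonBracket_Ly_coeff A F c (SpinTop.Ham A F c φ) x
  rw [hbr] at hbr'
  refine ⟨SpinTop.My_eq F c X, hbr', fun γ t ht => ?_⟩
  subst ht
  refine ⟨fun hγ => ?_, ?_, SpinTop.laxEquationAt_iff A F c X γ t⟩
  · intro d i j
    have h1 := (SpinTop.hasLoopDerivAt_Ly A F c hγ).coeff d i j
    simp only [SpinTop.poissonBracket_coord] at h1
    rw [hbr] at h1
    exact h1
  · simp only [hbr']
    rfl
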